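/- **Setting.** A parity game consists of a finite nonempty vertex set $V$ with $n$ elements, partitioned into the vertices $V_{\mathcal E}$ of player $\mathcal E$ and $V_{\mathcal O}$ of player $\mathcal O$, an edge relation in which every vertex has a successor, and a priority function $\alpha:V\to C=\{0,\dots,d-1\}$; $V_c=\alpha^{-1}(c)$. Player $\mathcal E$ wins a play iff the highest priority occurring infinitely often is even, otherwise player $\mathcal O$ wins it. The winning set of a player is the set of vertices from which she has a (memoryless) strategy that wins against all (memoryless) strategies of the opponent. A set-based symbolic algorithm may compute arbitrarily on non-symbolic data, but accesses the game only through the sets $V,V_{\mathcal E},V_{\mathcal O},V_c$, basic set operations ($\cup,\cap,\setminus,\subseteq,=$) and the one-step operation $\mathrm{Pre}(S)=\{v: v\text{ has a successor in }S\}$. Symbolic space is the maximal number of sets stored simultaneously. **Black box algorithm.** Let $(\mathcal W,\preceq)$ be a finite total order with minimum $\min$ and maximum $\top$, and let $\mathrm{lift}:\mathcal W\times C\to\mathcal W$. The algorithm stores sets $S_{\succeq r}$ for finitely many keys $r\in\mathcal W$ (for other $r$, $S_{\succeq r}$ is the set at the next larger key) and a list of active keys. Initially $S_{\succeq\min}=V$,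 $S_{\succeq\top}=\emptyset$, and only $\min$ is active. While there is an active key, the first one, $r$, is made inactive, and $P=\mathrm{CPre}_{\mathcal E}(S_{\succeq r})$ is computed, i.e. the set of vertices of $\mathcal E$ with some successor in $S_{\succeq r}$ and of vertices of $\mathcal O$ with all successors in $S_{\succeq r}$. For each $c\in C$ the following is done: start with $r'=\mathrm{lift}(r,c)$; as long as $P\cap V_c\not\subseteq S_{\succeq r'}$, let $S=S_{\succeq r'}\cup(P\cap V_c)$; if $r'=\top$ or $S$ strictly contains the set at the next key above $r'$, store $S$ at $r'$ and make $r'$ active; remove the largest key $p$ below $r'$ (also from the active list) as long as it exists and $S=S_{\succeq p}\cup(P\cap V_c)$; replace $r'$ by the largest key below it (by $\min$ if there is none). Finally, $S_{\succeq\top}$ is returned. **Ordered progress measure.** Order $C\cup\{\_\}$ by $\_\prec\cdots\prec5\prec3\prec1\prec0\prec2\prec4\prec\cdots$. A witness is a tuple of length $k=\lfloor\log_2 n\rfloor+1$ over $C\cup\{\_\}$ whose priorities (entries other than $\_$) are weakly decreasing from the most to the least significant position. $\mathcal W$ consists of the witnesses, ordered lexicographically, and a largest element $\top$; its minimum is the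 tuple of blanks. For a witness $b$ and $c\in C$ define $\mathrm{up}(b,c)$ as follows: if $c$ and all entries of $b$ are even priorities, it is $\top$; otherwise write $c$ at the most significant position $j$ such that $b_j$ is a priority less than $c$, or such that $c$ is even, $b_j$ is not an even priority and all less significant entries are even priorities, and write blanks at all less significant positions; if there is no such $j$, then $\mathrm{up}(b,c)=b$. Let $\mathrm{up}(\top,c)=\top$ and $\mathrm{lift}(r,c)=\min\{\mathrm{up}(s,c): s\in\mathcal W,\ s\succeq r\}$. **Theorem.** For every parity game with $n\ge1$ vertices and $d$ priorities, the black box algorithm, instantiated with the ordered progress measure $(\mathcal W,\mathrm{lift})$, terminates and returns the winning set of player $\mathcal E$, whose complement is the winning set of player $\mathcal O$. It uses $O(n\cdot|\mathcal W|)$ one-step operations, $O(d\cdot n\cdot|\mathcal W|)$ basic set operations, and $O(n)$ symbolic space. Moreover, if $n\ge2$, then $|\mathcal W|$ and the total number of symbolic operations are at most $n^{O(1+\log d)}$, and if $d\le\log_2 n$, then both are at most $n^{O(1)}$. All constants are absolute. -/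

import Mathlib

/-! ## Parity games -/

/-- The two players `𝓔` (even) and `𝓞` (odd). -/
inductive Player
  | even
  | odd

/-- A parity game with vertex set `V` and priorities `0, …, d - 1`. -/
structure ParityGame (V : Type*) (d : ℕ) where
  edge : V → V → Prop
  exists_edge : ∀ v, ∃ w, edge v w
  owner : V → Player
  priority : V → Fin d

namespace ParityGame

variable {V : Type*} {d : ℕ} (G : ParityGame V d)

/-- A memoryless strategy of player `z`: a choice of a successor for each vertex of `z`. -/
def Strategy (z : Player) : Type _ :=
  {σ : {v // G.owner v = z} → V // ∀ v, G.edge v.1 (σ v)}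

/-- The move prescribed at `v` by the strategy of the owner of `v`. -/
def move (σ : G.Strategy .even) (π : G.Strategy .odd) (v : V) : V :=
  match h : G.owner v with
  | .even => σ.1 ⟨v, h⟩
  | .odd => π.1 ⟨v, h⟩

/-- The unique play from `s` that is consistent with both strategies. -/
def play (s : V) (σ : G.Strategy .even) (π : G.Strategy .odd) : ℕ → V
  | 0 => s
  | i + 1 => G.move σ π (play s σ π i)

/-- `c` is the highest priority that occurs infinitely often in `ρ`. -/
def IsLimitPriority (ρ : ℕ → V) (c : Fin d) : Prop :=
  IsGreatest {c' | ∃ᶠ i in Filter.atTop, G.priority (ρ i) = c'} c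

/-- Player `z` wins the play `ρ`. -/
def Wins (z : Player) (ρ : ℕ → V) : Prop :=
  match z with
  | .even => ∃ c : Fin d, G.IsLimitPriority ρ c ∧ Even c.val
  | .odd => ∃ c : Fin d, G.IsLimitPriority ρ c ∧ Odd c.val

/-- The winning set of player `z`. -/
def winSet (z : Player) : Set V :=
  match z with
  | .even => {s | ∃ σ : G.Strategy .even, ∀ π : G.Strategy .odd, G.Wins .even (G.play s σ π)}
  | .odd => {s | ∃ π : G.Strategy .odd, ∀ σ : G.Strategy .even, G.Wins .odd (G.play s σ π)}

/-- The predecessor operation `Pre(S)`. -/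
def Pre (S : Set V) : Set V := {v | ∃ w, G.edge v w ∧ w ∈ S}

end ParityGame

/-! ## The set-based symbolic model of computation

A program works on a non-symbolic memory, whose content is an element of `σ` and on which arbitrary
computations are allowed, and on a symbolic memory, whose cells have addresses in `R` and hold at
most one set of vertices each. The game is accessible only through set operations, set comparisons
and the operation `Pre`; the type of programs does not mention the game or its vertices. -/

namespace Symbolic

/-- The operands of symbolic operations: a stored set, or one of the read-only input sets
`V`, `V_𝓔`, `V_𝓞`, `V_c`. -/
inductive Operand (d : ℕ) (R : Type)
  | cell (x : R)
  | all
  | owned (z : Player)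
  | prio (c : Fin d)

inductive SetOp
  | union
  | inter
  | diff

inductive SetTest
  | subset
  | eq

/-- While-programs. Addresses and operands may depend on the non-symbolic memory; the answer of a
set comparison is handed over to the non-symbolic memory. -/
inductive Cmd (d : ℕ) (σ R : Type)
  | skip
  | assign (f : σ → σ)
  | setOp (o : SetOp) (x : σ → R) (a b : σ → Operand d R)
  | pre (x : σ → R) (a : σ → Operand d R)
  | test (t : SetTest) (a b : σ → Operand d R) (f : Bool → σ → σ)
  | free (x : σ → R)
  | seq (p q : Cmd d σ R)
  | ite (b : σ → Bool) (p q : Cmd d σ R)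
  | while (b : σ → Bool) (p : Cmd d σ R)

/-- Sequential composition of a list of programs. -/
def Cmd.block {d : ℕ} {σ R : Type} : List (Cmd d σ R) → Cmd d σ R
  | [] => .skip
  | p :: ps => .seq p (block ps)

variable {d : ℕ} {σ R : Type} {V : Type*}

def SetOp.apply : SetOp → Set V → Set V → Set V
  | .union, A, B => A ∪ B
  | .inter, A, B => A ∩ B
  | .diff, A, B => A \ B

def SetTest.Holds : SetTest → Set V → Set V → Prop
  | .subset, A, B => A ⊆ B
  | .eq, A, B => A = B

/-- A configuration: the content of the two memories. A cell with content `none` is empty, i.e. it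
stores no set at all (and not the empty set). -/
structure Config (σ R : Type) (V : Type*) where
  loc : σ
  mem : R → Option (Set V)

/-- The number of sets that are currently stored. -/
def Config.stored [Fintype R] (s : Config σ R V) : ℕ :=
  (Finset.univ.filter fun x => (s.mem x).isSome).card

/-- The set denoted by an operand; undefined for an empty cell. -/
def Operand.eval (G : ParityGame V d) (m : R → Option (Set V)) : Operand d R → Option (Set V)
  | .cell x => m x
  | .all => some Set.univ
  | .owned z => some {v | G.owner v = z}
  | .prio c => some {v | G.priority v = c}

/-- Symbolic resources: the number of one-step operations, the number of basic set operations, and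
the maximal number of simultaneously stored sets. -/
structure Cost where
  oneStep : ℕ
  basic : ℕ
  space : ℕ

def Cost.comp (k l : Cost) : Cost :=
  ⟨k.oneStep + l.oneStep, k.basic + l.basic, max k.space l.space⟩

open Classical in
/-- `Exec G p s t k`: on the game `G`, program `p` started in configuration `s` terminates in
configuration `t` and uses the resources `k`. -/
inductive Exec [Fintype R] (G : ParityGame V d) :
    Cmd d σ R → Config σ R V → Config σ R V → Cost → Prop
  | skip (s : Config σ R V) : Exec G .skip s s ⟨0, 0, s.stored⟩
  | assign (f : σ → σ) (s : Config σ R V) :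
      Exec G (.assign f) s ⟨f s.loc, s.mem⟩ ⟨0, 0, s.stored⟩
  | setOp (o : SetOp) (x : σ → R) (a b : σ → Operand d R) (s t : Config σ R V) (A B : Set V)
      (hA : (a s.loc).eval G s.mem = some A) (hB : (b s.loc).eval G s.mem = some B)
      (ht : t = ⟨s.loc, Function.update s.mem (x s.loc) (some (o.apply A B))⟩) :
      Exec G (.setOp o x a b) s t ⟨0, 1, max s.stored t.stored⟩
  | pre (x : σ → R) (a : σ → Operand d R) (s t : Config σ R V) (A : Set V)
      (hA : (a s.loc).eval G s.mem = some A)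
      (ht : t = ⟨s.loc, Function.update s.mem (x s.loc) (some (G.Pre A))⟩) :
      Exec G (.pre x a) s t ⟨1, 0, max s.stored t.stored⟩
  | test (t : SetTest) (a b : σ → Operand d R) (f : Bool → σ → σ) (s : Config σ R V)
      (A B : Set V)
      (hA : (a s.loc).eval G s.mem = some A) (hB : (b s.loc).eval G s.mem = some B) :
      Exec G (.test t a b f) s ⟨f (decide (t.Holds A B)) s.loc, s.mem⟩ ⟨0, 1, s.stored⟩
  | free (x : σ → R) (s : Config σ R V) :
      Exec G (.free x) s ⟨s.loc, Function.update s.mem (x s.loc) none⟩ ⟨0, 0, s.stored⟩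
  | seq (p q : Cmd d σ R) (s t u : Config σ R V) (k l : Cost)
      (hp : Exec G p s t k) (hq : Exec G q t u l) : Exec G (.seq p q) s u (k.comp l)
  | ite_true (b : σ → Bool) (p q : Cmd d σ R) (s t : Config σ R V) (k : Cost)
      (hb : b s.loc = true) (hp : Exec G p s t k) : Exec G (.ite b p q) s t k
  | ite_false (b : σ → Bool) (p q : Cmd d σ R) (s t : Config σ R V) (k : Cost)
      (hb : b s.loc = false) (hq : Exec G q s t k) : Exec G (.ite b p q) s t k
  | while_false (b : σ → Bool) (p : Cmd d σ R) (s : Config σ R V)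
      (hb : b s.loc = false) : Exec G (.while b p) s s ⟨0, 0, s.stored⟩
  | while_true (b : σ → Bool) (p : Cmd d σ R) (s t u : Config σ R V) (k l : Cost)
      (hb : b s.loc = true) (hp : Exec G p s t k) (hq : Exec G (.while b p) t u l) :
      Exec G (.while b p) s u (k.comp l)

end Symbolic

/-! ## The black box set-based symbolic progress measure algorithm -/

namespace BlackBox

open Symbolic

/-- The addresses of the symbolic memory: `node r` holds the set that the node `r` of the search
tree points to; the others hold the program variables that are sets. -/
inductive Cell (W : Type)
  | node (r : W)
  | P
  | X
  | S
  | T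
  deriving DecidableEq, Fintype

/-- The non-symbolic memory. `keys` are the elements of `W` in the search tree and `active` is the
list of active elements; `r` and `r'` are the variables of the algorithm of type `W`, and `flag`
holds the answers of set comparisons. -/
structure State (W : Type) where
  keys : Finset W
  active : List W
  r : W
  r' : W
  flag : Bool

variable {W : Type} [LinearOrder W] [BoundedOrder W] {d : ℕ}

/-- The node found by `D.getSet(r)`: the smallest stored element that is at least `r`. -/
def ceil (s : State W) (r : W) : W := (s.keys.filter (r ≤ ·)).inf id

/-- `D.getNext(r)`: the smallest stored element above `r` (`⊤` if there is none). -/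
def getNext (s : State W) (r : W) : W := (s.keys.filter (r < ·)).inf id

/-- `D.getPrevious(r)`: the largest stored element below `r` (`min` if there is none). -/
def getPrevious (s : State W) (r : W) : W := (s.keys.filter (· < r)).sup id

/-- The stored set that represents `D.getSet(r)`. -/
def getSet (s : State W) (r : W) : Operand d (Cell W) := .cell (.node (ceil s r))

/-- `D.activate(r')`. -/
def activate (s : State W) : State W :=
  if s.r' ∈ s.active then s else { s with active := s.active ++ [s.r'] }

/-- `D.popActiveSet()`, for a nonempty list of active elements. -/
def popActiveSet (s : State W) : State W :=
  { s with r := s.active.headD ⊥, active := s.active.tail }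

/-- `D.update(r', S)`. The set is copied, which is counted as a basic set operation. -/
def update : Cmd d (State W) (Cell W) := .block [
  .setOp .union (fun s => .node s.r') (fun _ => .cell .S) (fun _ => .cell .S),
  .assign fun s => { s with keys := insert s.r' s.keys }]

/-- There is a stored element below `r`. -/
def hasPrevious (s : State W) (r : W) : Bool := decide (∃ x ∈ s.keys, x < r)

/-- `D.removeSet(D.getPrevious(r'))`. -/
def removePrevious : Cmd d (State W) (Cell W) := .block [
  .free fun s => .node (getPrevious s s.r'),
  .assign fun s => { s with
    keys := s.keys.erase (getPrevious s s.r')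
    active := s.active.erase (getPrevious s s.r') }]

/-- Initialization of `D`, with `D.update(min, V)` and `D.update(⊤, ∅)`, and `D.activate(min)`. -/
def initialize_D : Cmd d (State W) (Cell W) := .block [
  .setOp .union (fun _ => .node ⊥) (fun _ => .all) (fun _ => .all),
  .setOp .diff (fun _ => .node ⊤) (fun _ => .all) (fun _ => .all),
  .assign fun s => { s with keys := {⊥, ⊤}, active := [⊥] }]

/-- `P ← CPre_𝓔(S_{⪰ r}) = (V_𝓔 ∩ Pre(S_{⪰ r})) ∪ (V_𝓞 \ Pre(V \ S_{⪰ r}))`. -/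
def controllablePre : Cmd d (State W) (Cell W) := .block [
  .pre (fun _ => .P) (fun s => getSet s s.r),
  .setOp .inter (fun _ => .P) (fun _ => .owned .even) (fun _ => .cell .P),
  .setOp .diff (fun _ => .X) (fun _ => .all) (fun s => getSet s s.r),
  .pre (fun _ => .X) (fun _ => .cell .X),
  .setOp .diff (fun _ => .X) (fun _ => .owned .odd) (fun _ => .cell .X),
  .setOp .union (fun _ => .P) (fun _ => .cell .P) (fun _ => .cell .X)]

/-- The test `P ∩ V_c ⊈ S_{⪰ r'}`, where `X` holds `P ∩ V_c`. -/
def testInner : Cmd d (State W) (Cell W) :=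
  .test .subset (fun _ => .cell .X) (fun s => getSet s s.r') fun ans s => { s with flag := !ans }

/-- The test `S_{⪰ r'} = S_{⪰ prev(r')} ∪ (P ∩ V_c)`, where `prev(r')` has to exist. -/
def testPrevious : Cmd d (State W) (Cell W) := .block [
  .setOp .union (fun _ => .T) (fun s => getSet s (getPrevious s s.r')) (fun _ => .cell .X),
  .test .eq (fun _ => .cell .S) (fun _ => .cell .T)
    fun ans s => { s with flag := ans && hasPrevious s s.r' }]

/-- The body of the inner while-loop. All stored sets that become equal to `S_{⪰ r'}` are removed. -/
def innerBody : Cmd d (State W) (Cell W) := .block [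
  .setOp .union (fun _ => .S) (fun s => getSet s s.r') (fun _ => .cell .X),
  .ite (fun s => s.r' = ⊤)
    (.assign fun s => { s with flag := true })
    (.block [
      .test .subset (fun s => getSet s (getNext s s.r')) (fun _ => .cell .S)
        fun ans s => { s with flag := ans },
      .test .eq (fun s => getSet s (getNext s s.r')) (fun _ => .cell .S)
        fun ans s => { s with flag := s.flag && !ans }]),
  .ite (fun s => s.flag) (.block [update, .assign activate]) .skip,
  testPrevious,
  .while (fun s => s.flag) (.block [removePrevious, testPrevious]),
  .assign fun s => { s with r' := getPrevious s s.r' },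
  testInner]

/-- The body of the for-loop, for the priority `c`. -/
def forBody (lift : W → Fin d → W) (c : Fin d) : Cmd d (State W) (Cell W) := .block [
  .assign fun s => { s with r' := lift s.r c },
  .setOp .inter (fun _ => .X) (fun _ => .cell .P) (fun _ => .prio c),
  testInner,
  .while (fun s => s.flag) innerBody]

/-- The body of the outer while-loop. -/
def outerBody (lift : W → Fin d → W) : Cmd d (State W) (Cell W) := .block [
  .assign popActiveSet,
  controllablePre,
  .block ((List.finRange d).map (forBody lift))]

/-- The algorithm. Its result `S_⊤` is the content of the cell `node ⊤` upon termination. -/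
def algorithm (lift : W → Fin d → W) : Cmd d (State W) (Cell W) := .block [
  initialize_D,
  .while (fun s => !s.active.isEmpty) (outerBody lift)]

/-- The configuration in which the algorithm starts; no set is stored. -/
def start (W : Type) [LinearOrder W] [BoundedOrder W] (V : Type*) :
    Config (State W) (Cell W) V :=
  ⟨⟨∅, [], ⊥, ⊥, false⟩, fun _ => none⟩

end BlackBox

/-! ## The ordered progress measure -/

namespace OPM

/-- `C ∪ {_}`: a priority, or the blank. -/
inductive Digit (d : ℕ)
  | blank
  | prio (p : Fin d)
  deriving DecidableEq, Fintype

namespace Digit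

variable {d : ℕ}

/-- The position of a digit in the order `_ ≺ ⋯ ≺ 5 ≺ 3 ≺ 1 ≺ 0 ≺ 2 ≺ 4 ≺ ⋯`. -/
def value : Digit d → WithBot ℤ
  | .blank => ⊥
  | .prio p => ((if Even p.val then (p.val : ℤ) else -(p.val : ℤ) : ℤ) : WithBot ℤ)

theorem value_injective : Function.Injective (value (d := d)) := by
  rintro (_ | p) (_ | q) h
  · rfl
  · simp [value] at h
  · simp [value] at h
  · have h' : (if Even p.val then (p.val : ℤ) else -(p.val : ℤ)) =
        (if Even q.val then (q.val : ℤ) else -(q.val : ℤ)) := WithBot.coe_injective h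
    have : p = q := by
      apply Fin.ext
      split_ifs at h' with hp hq hq <;> grind
    rw [this]

noncomputable instance : LinearOrder (Digit d) := LinearOrder.lift' value value_injective

/-- The digit is an even priority. -/
def IsEven (x : Digit d) : Prop := ∃ p : Fin d, x = .prio p ∧ Even p.val

/-- The digit is a priority smaller than `c`. -/
def IsBelow (x : Digit d) (c : Fin d) : Prop := ∃ p : Fin d, x = .prio p ∧ p < c

end Digit

variable {k d : ℕ}

/-- The priorities in the tuple (its entries other than blanks) are weakly decreasing, from the
most significant position `0` to the least significant position `k - 1`. -/
def IsWitness (b : Fin k → Digit d) : Prop :=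
  ∀ i j : Fin k, i < j → ∀ p q : Fin d, b i = .prio p → b j = .prio q → q ≤ p

/-- The witnesses with `k` positions, ordered lexicographically. -/
def Witness (k d : ℕ) : Type := {b : Lex (Fin k → Digit d) // IsWitness (ofLex b)}

noncomputable instance : LinearOrder (Witness k d) :=
  inferInstanceAs (LinearOrder {b : Lex (Fin k → Digit d) // IsWitness (ofLex b)})

noncomputable instance : Fintype (Witness k d) :=
  haveI : Fintype (Lex (Fin k → Digit d)) := inferInstanceAs (Fintype (Fin k → Digit d))
  Fintype.ofInjective (Subtype.val : Witness k d → Lex (Fin k → Digit d)) Subtype.val_injective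

/-- The blank witness. -/
instance : OrderBot (Witness k d) where
  bot := ⟨toLex fun _ => .blank, fun _ _ _ _ _ h => by simp at h⟩
  bot_le b := Pi.toLex_monotone (a := fun _ : Fin k => Digit.blank) (b := ofLex b.1) fun i => by
    change Digit.value .blank ≤ Digit.value _
    exact bot_le

/-- Reading the priority `c` may change the witness `b` at position `j`, if the priority at `j` is
smaller than `c`, or if `c` is even, the digit at `j` is not an even priority and all digits at
less significant positions are even priorities. -/
def Updatable (b : Fin k → Digit d) (c : Fin d) (j : Fin k) : Prop :=
  (b j).IsBelow c ∨ (Even c.val ∧ ¬ (b j).IsEven ∧ ∀ i, j < i → (b i).IsEven)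

/-- Write `c` at position `j` and blanks at all less significant positions. -/
def write (b : Fin k → Digit d) (c : Fin d) (j : Fin k) : Fin k → Digit d :=
  fun i => if i < j then b i else if i = j then .prio c else .blank

theorem isWitness_write {b : Fin k → Digit d} (hb : IsWitness b) {c : Fin d} {j : Fin k}
    (hj : ∀ i, i < j → ¬ Updatable b c i) : IsWitness (write b c j) := by
  intro i i' hii p q hp hq
  unfold write at hp hq
  by_cases h' : i' < j
  · rw [if_pos (hii.trans h')] at hp
    rw [if_pos h'] at hq
    exact hb i i' hii p q hp hq
  · rw [if_neg h'] at hq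
    by_cases h : i' = j
    · rw [if_pos h] at hq
      have hi : i < j := h ▸ hii
      rw [if_pos hi] at hp
      have hc : c = q := Digit.prio.inj hq
      subst hc
      exact le_of_not_gt fun hlt => hj i hi (Or.inl ⟨p, hp, hlt⟩)
    · rw [if_neg h] at hq
      exact absurd hq (by simp)

/-- The rank set: the witnesses with an additional largest element `⊤` (the game is won). -/
abbrev Rank (k d : ℕ) : Type := WithTop (Witness k d)

open Classical in
/-- The update of a witness `b` by the priority `c`: if `c` is even and all digits of `b` are even
priorities, the game is won; otherwise `c` is written at the most significant position that may be
changed, and `b` remains unchanged if there is no such position. -/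
noncomputable def witnessUpdate (b : Witness k d) (c : Fin d) : Rank k d :=
  if Even c.val ∧ ∀ i, (ofLex b.1 i).IsEven then ⊤
  else if h : ∃ j, Updatable (ofLex b.1) c j ∧ ∀ i, i < j → ¬ Updatable (ofLex b.1) c i then
    WithTop.some
      (⟨toLex (write (ofLex b.1) c h.choose), isWitness_write b.2 h.choose_spec.2⟩ : Witness k d)
  else WithTop.some b

/-- The basic update. -/
noncomputable def basicUpdate : Rank k d → Fin d → Rank k d
  | ⊤, _ => ⊤
  | (b : Witness k d), c => witnessUpdate b c

/-- The `lift` function (the antagonistic update): before `c` is read, the opponent may replace the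
rank by any larger one, and she aims at a smallest result. -/
noncomputable def lift (r : Rank k d) (c : Fin d) : Rank k d :=
  (Finset.univ.filter (r ≤ ·)).inf fun s => basicUpdate s c

/-- The ranks used for games with `n` vertices; witnesses have `⌊log₂ n⌋ + 1` positions. -/
abbrev 𝓦 (n d : ℕ) : Type := Rank (Nat.log 2 n + 1) d

end OPM

/-! Call `g` a measure if `lift (g w) (priority v) ≤ g v` holds for every successor `w` of a vertex
`v` of player `𝓔`, and for a `g`-minimal successor if `v` belongs to player `𝓞`; this is the content
of `IsMeasure`. The algorithm computes the least measure: every set it stores lies inside the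
corresponding level set of every measure (`OuterInv.sound`), and upon termination the sets are
themselves the level sets of a measure (`OuterInv.exists_isMeasure`). What remains is to locate the
value `⊤` of the least measure. By positional determinacy (`exists_forces_cover`) the vertices split
into a winning region of each player, so two facts suffice.

Every measure is `⊤` on the region of `𝓔` (`eq_top_of_forces_even`). Let `𝓔` follow her winning
strategy and `𝓞` always move to a successor of minimal measure. If the ranks stayed below `⊤`, then,
after identifying all priorities below the even limit priority `p`, they would eventually never
increase and would drop at each occurrence of `p` (`collapse_le_of_lift`). This is impossible in a
finite order.

Some measure is below `⊤` on the region of `𝓞` (`exists_isMeasure_lt_top`). Take the largest rank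
obtained by reading the priorities of reversed paths that respect the strategy of `𝓞`. The digits of
a rank act as a binary counter, and reaching `⊤` yields `2 ^ k > n` times any two of which enclose
an even highest priority (`exists_evenChain_of_readRank_eq_top`). Two of these times share a vertex,
and going around the resulting cycle forever would be a win for `𝓔`.

Resources are amortized. The stored sets form one strict chain of subsets of `V`, or two of them
during an update, so there are at most `2 * n + 2` of them beside four variables. The potential
`L.length + slack φ` drops with each round of the outer loop, since an activation is paid for by a
vertex newly added to a set. Removals are paid for by the keys they delete. The rank counts come
from counting all tuples, or from encoding a witness by two finite sets. -/

namespace ParityGame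

/-! ### Positional determinacy of finite parity games. -/

variable {V : Type*} {d : ℕ} (G : ParityGame V d)

theorem isLimitPriority_add_iff (ρ : ℕ → V) (m : ℕ) (c : Fin d) :
    G.IsLimitPriority (fun i => ρ (i + m)) c ↔ G.IsLimitPriority ρ c := by
  have h : ∀ c', (∃ᶠ i in Filter.atTop, G.priority (ρ (i + m)) = c') ↔
      ∃ᶠ i in Filter.atTop, G.priority (ρ i) = c' := fun c' => by
    conv_rhs => rw [← Filter.map_add_atTop_eq_nat m]
    rw [Filter.frequently_map]
  unfold IsLimitPriority
  simp only [h]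

theorem wins_add_iff (z : Player) (ρ : ℕ → V) (m : ℕ) :
    G.Wins z (fun i => ρ (i + m)) ↔ G.Wins z ρ := by
  cases z <;> simp only [Wins, isLimitPriority_add_iff]

/-- The player who wins the plays with limit priority `c`. -/
def winnerOf (c : Fin d) : Player := if Even c.val then .even else .odd

theorem wins_of_isLimitPriority {ρ : ℕ → V} {c : Fin d} (h : G.IsLimitPriority ρ c) :
    G.Wins (winnerOf c) ρ := by
  unfold winnerOf
  split_ifs with hc
  · exact ⟨c, h, hc⟩
  · exact ⟨c, h, Nat.not_even_iff_odd.1 hc⟩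

theorem not_wins_even_and_odd {ρ : ℕ → V} (h : G.Wins .even ρ) (h' : G.Wins .odd ρ) : False := by
  obtain ⟨c, hc, he⟩ := h
  obtain ⟨c', hc', ho⟩ := h'
  rw [hc.unique hc'] at he
  exact Nat.not_even_iff_odd.2 ho he

/-- A path in which all moves of player `z` are given by `σ`. -/
def Follows (z : Player) (σ : V → V) (x : ℕ → V) : Prop :=
  ∀ i, G.edge (x i) (x (i + 1)) ∧ (G.owner (x i) = z → x (i + 1) = σ (x i))

/-- In the subgame `B`, the strategy `σ` of player `z` keeps all plays that start in `W` in `W`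
until they visit `N`, and the plays that never visit `N` satisfy `Φ`. -/
structure Forces (z : Player) (B N W : Set V) (Φ : (ℕ → V) → Prop) (σ : V → V) : Prop where
  subset : W ⊆ B
  own : ∀ v ∈ W, v ∉ N → G.owner v = z → G.edge v (σ v) ∧ σ v ∈ W
  opp : ∀ v ∈ W, v ∉ N → G.owner v ≠ z → ∀ w ∈ B, G.edge v w → w ∈ W
  plays : ∀ x : ℕ → V, (∀ i, x i ∈ W) → (∀ i, x i ∉ N) → G.Follows z σ x → Φ x

variable {G} {z : Player} {B N W : Set V} {Φ : (ℕ → V) → Prop} {σ : V → V}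

theorem Follows.add {x : ℕ → V} (hx : G.Follows z σ x) (m : ℕ) :
    G.Follows z σ fun i => x (i + m) := fun i => by
  have := hx (i + m)
  rw [show i + m + 1 = i + 1 + m by ring] at this
  exact this

/-- One attractor step: a play leaving the new vertex `v` is in `W` one move later and stays there,
so only a tail has to satisfy `Φ`. As `v ∉ W`, redefining the strategy at `v` does not disturb it on
`W`. -/
theorem Forces.insert (h : G.Forces z B N W Φ σ) (hΦ : ∀ x m, Φ (fun i => x (i + m)) → Φ x)
    {v : V} (hvB : v ∈ B) (hvW : v ∉ W) (hz : G.owner v = z → ∃ w ∈ W, G.edge v w)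
    (hz' : G.owner v ≠ z → ∀ w ∈ B, G.edge v w → w ∈ W) :
    ∃ σ', G.Forces z B N (insert v W) Φ σ' := by
  classical
  obtain ⟨w, hw⟩ : ∃ w, G.owner v = z → w ∈ W ∧ G.edge v w := by
    by_cases ho : G.owner v = z
    · obtain ⟨w, hw⟩ := hz ho
      exact ⟨w, fun _ => hw⟩
    · exact ⟨v, fun h => absurd h ho⟩
  have hne : ∀ u ∈ W, Function.update σ v w u = σ u := fun u hu =>
    Function.update_of_ne (fun (e : u = v) => hvW (e ▸ hu)) _ _
  refine ⟨Function.update σ v w, Set.insert_subset hvB h.subset, ?_, ?_, ?_⟩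
  · rintro u (rfl | hu) huN ho
    · simpa [(hw ho).1] using (hw ho).2
    · rw [hne u hu]
      exact ⟨(h.own u hu huN ho).1, Or.inr (h.own u hu huN ho).2⟩
  · rintro u (rfl | hu) huN ho u' hu' he
    · exact Or.inr (hz' ho u' hu' he)
    · exact Or.inr (h.opp u hu huN ho u' hu' he)
  · intro x hxW hxN hx
    have hxB : ∀ i, x i ∈ B := fun i => Set.insert_subset hvB h.subset (hxW i)
    obtain ⟨m, hm⟩ : ∃ m, x m ∈ W := by
      by_cases h0 : x 0 = v
      · refine ⟨1, ?_⟩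
        by_cases ho : G.owner v = z
        · have := (hx 0).2 (h0.symm ▸ ho)
          rw [h0, Function.update_self] at this
          exact this ▸ (hw ho).1
        · exact hz' ho _ (hxB 1) (h0 ▸ (hx 0).1)
      · exact ⟨0, (hxW 0).resolve_left h0⟩
    have hmem : ∀ i, x (i + m) ∈ W := by
      intro i
      induction i with
      | zero => simpa using hm
      | succ i ih =>
        rw [show i + 1 + m = i + m + 1 by ring]
        by_cases ho : G.owner (x (i + m)) = z
        · rw [(hx _).2 ho, hne _ ih]
          exact (h.own _ ih (hxN _) ho).2
        · exact h.opp _ ih (hxN _) ho _ (hxB _) (hx _).1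
    refine hΦ x m (h.plays _ hmem (fun i => hxN _) fun i => ?_)
    have := hx.add m i
    rwa [hne _ (hmem i)] at this

theorem Forces.mono_subgame {C : Set V} (h : G.Forces z C N W Φ σ) (hCB : C ⊆ B)
    (hC : ∀ v ∈ W, G.owner v ≠ z → ∀ w ∈ B, G.edge v w → w ∈ C) : G.Forces z B N W Φ σ :=
  ⟨h.subset.trans hCB, h.own,
    fun v hv hN ho w hw he => h.opp v hv hN ho w (hC v hv ho w hw he) he, h.plays⟩

/-- The opponent can escape from `W'` only into `W`, where `σ` takes over for good. A play therefore
either has a tail in `W` or stays in `W'` forever. -/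
theorem Forces.union {W' : Set V} {σ' : V → V} (h : G.Forces z B ∅ W Φ σ)
    (h' : G.Forces z (B \ W) ∅ W' Φ σ') (hΦ : ∀ x m, Φ (fun i => x (i + m)) → Φ x) :
    ∃ τ, G.Forces z B ∅ (W ∪ W') Φ τ := by
  classical
  have hd : ∀ v ∈ W', v ∉ W := fun v hv => (h'.subset hv).2
  have hB : W ∪ W' ⊆ B := Set.union_subset h.subset (h'.subset.trans Set.sdiff_subset)
  refine ⟨fun v => if v ∈ W then σ v else σ' v, hB, ?_, ?_, ?_⟩
  · rintro v (hv | hv) hN ho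
    · simp only [if_pos hv]
      exact ⟨(h.own v hv hN ho).1, Or.inl (h.own v hv hN ho).2⟩
    · simp only [if_neg (hd v hv)]
      exact ⟨(h'.own v hv hN ho).1, Or.inr (h'.own v hv hN ho).2⟩
  · rintro v (hv | hv) hN ho w hw he
    · exact Or.inl (h.opp v hv hN ho w hw he)
    · by_cases hwW : w ∈ W
      · exact Or.inl hwW
      · exact Or.inr (h'.opp v hv hN ho w ⟨hw, hwW⟩ he)
  · intro x hxW hxN hx
    by_cases hm : ∃ m, x m ∈ W
    · obtain ⟨m, hm⟩ := hm
      have hmem : ∀ i, x (i + m) ∈ W := by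
        intro i
        induction i with
        | zero => simpa using hm
        | succ i ih =>
          rw [show i + 1 + m = i + m + 1 by ring]
          by_cases ho : G.owner (x (i + m)) = z
          · rw [(hx _).2 ho, if_pos ih]
            exact (h.own _ ih (hxN _) ho).2
          · exact h.opp _ ih (hxN _) ho _ (hB (hxW _)) (hx _).1
      refine hΦ x m (h.plays _ hmem (fun i => hxN _) fun i => ?_)
      have := hx.add m i
      rwa [if_pos (hmem i)] at this
    · push Not at hm
      refine h'.plays x (fun i => (hxW i).resolve_left (hm i)) hxN fun i => ?_
      have := hx i
      rwa [if_neg (hm i)] at this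

theorem forces_empty (z : Player) (B : Set V) (Φ : (ℕ → V) → Prop) :
    G.Forces z B ∅ ∅ Φ id :=
  ⟨Set.empty_subset _, fun _ h => h.elim, fun _ h => h.elim, fun _ h => (h 0).elim⟩

/-- The seed of an attractor: with `Φ` false, a region grown from `N` by `Forces.insert` is one in
which no play can avoid `N` forever. -/
theorem forces_self (z : Player) (hN : N ⊆ B) (Φ : (ℕ → V) → Prop) :
    G.Forces z B N N Φ id :=
  ⟨hN, fun _ h h' => absurd h h', fun _ h h' => absurd h h', fun _ h h' => absurd (h 0) (h' 0)⟩

/-- The opponent of a player. -/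
def _root_.Player.other : Player → Player
  | .even => .odd
  | .odd => .even

theorem _root_.Player.eq_or_eq_other (y z : Player) : y = z ∨ y = z.other := by
  cases y <;> cases z <;> simp [Player.other]

theorem _root_.Player.other_ne (z : Player) : z.other ≠ z := by
  cases z <;> simp [Player.other]

theorem _root_.Player.ne_iff {y z : Player} : y ≠ z ↔ y = z.other := by
  cases y <;> cases z <;> simp [Player.other]

/-- If the highest priority of the subgame `B` is good for `z`, and `z` wins the subgame outside an
attractor of the vertices of that priority, then `z` wins `B`. -/
theorem Forces.of_attractor [Finite V] {c : Fin d} {T C : Set V} {τ : V → V}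
    (hB : ∀ v ∈ B, ∃ w ∈ B, G.edge v w) (hc : ∀ v ∈ B, G.priority v ≤ c)
    (hN : ∀ v ∈ N, G.priority v = c)
    (hT : G.Forces (winnerOf c) B N T (fun _ => False) τ) (hC : C = B \ T)
    (h : G.Forces (winnerOf c) C ∅ C (G.Wins (winnerOf c)) σ) :
    ∃ σ', G.Forces (winnerOf c) B ∅ B (G.Wins (winnerOf c)) σ' := by
  classical
  have hnext : ∀ v, ∃ w, v ∈ B → w ∈ B ∧ G.edge v w := fun v => by
    by_cases hv : v ∈ B
    · obtain ⟨w, hw⟩ := hB v hv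
      exact ⟨w, fun _ => hw⟩
    · exact ⟨v, fun h => absurd h hv⟩
  choose nx hnx using hnext
  refine ⟨fun v => if v ∈ N then nx v else if v ∈ T then τ v else σ v, subset_rfl, ?_,
    fun v _ _ _ w hw _ => hw, ?_⟩
  · intro v hv _ ho
    split_ifs with h1 h2
    · exact (hnx v hv).symm
    · exact ⟨(hT.own v h2 h1 ho).1, hT.subset (hT.own v h2 h1 ho).2⟩
    · have hvC : v ∈ C := hC ▸ ⟨hv, h2⟩
      exact ⟨(h.own v hvC (by simp) ho).1, h.subset.trans (hC ▸ Set.sdiff_subset)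
        (h.own v hvC (by simp) ho).2⟩
  · intro x hxB _ hx
    -- Infinitely many visits to `N` make `c` the limit priority. Otherwise the play eventually
    -- avoids `N`, hence also `T`, from where a visit to `N` would be forced, and its tail is a play
    -- in `C`.
    by_cases hinf : ∃ᶠ i in Filter.atTop, x i ∈ N
    · apply wins_of_isLimitPriority
      refine ⟨hinf.mono fun i hi => hN _ hi, ?_⟩
      rintro c' hc'
      obtain ⟨i, hi⟩ := hc'.exists
      exact hi ▸ hc _ (hxB i)
    · rw [Filter.not_frequently, Filter.eventually_atTop] at hinf
      obtain ⟨m, hm⟩ := hinf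
      have hout : ∀ i ≥ m, x i ∉ T := by
        intro i hi hiT
        have hmem : ∀ j, x (j + i) ∈ T := by
          intro j
          induction j with
          | zero => simpa using hiT
          | succ j ih =>
            have hjN := hm (j + i) (by omega)
            rw [show j + 1 + i = j + i + 1 by ring]
            by_cases ho : G.owner (x (j + i)) = winnerOf c
            · rw [(hx _).2 ho, if_neg hjN, if_pos ih]
              exact (hT.own _ ih hjN ho).2
            · exact hT.opp _ ih hjN ho _ (hxB _) (hx _).1
        refine hT.plays _ hmem (fun j => hm _ (by omega)) fun j => ?_
        have := hx.add i j
        rwa [if_neg (hm _ (by omega)), if_pos (hmem j)] at this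
      rw [← wins_add_iff _ _ _ m]
      refine h.plays _ (fun i => hC ▸ ⟨hxB _, hout _ (by omega)⟩) (by simp) fun i => ?_
      have := hx.add m i
      rwa [if_neg (hm _ (by omega)), if_neg (hout _ (by omega))] at this

theorem exists_forces_maximal [Finite V] {P : Set V → Prop} (h : ∃ W, P W) :
    ∃ W, Maximal P W :=
  (Set.toFinite {W | P W}).exists_maximal h

/-- Positional determinacy of the subgames of a finite parity game. -/
theorem exists_forces_cover [Finite V] (G : ParityGame V d) (B : Set V)
    (hB : ∀ v ∈ B, ∃ w ∈ B, G.edge v w) :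
    ∃ W : Player → Set V, (∀ z, ∃ σ, G.Forces z B ∅ (W z) (G.Wins z) σ) ∧
      ∀ v ∈ B, ∃ z, v ∈ W z := by
  classical
  induction hn : B.ncard using Nat.strong_induction_on generalizing B with
  | _ n ih =>
  have hΦ : ∀ (z : Player) x m, G.Wins z (fun i => x (i + m)) → G.Wins z x := fun z x m =>
    (wins_add_iff G z x m).1
  have ih' : ∀ A : Set V, A ⊂ B → (∀ v ∈ A, ∃ w ∈ A, G.edge v w) →
      ∃ W : Player → Set V, (∀ z, ∃ σ, G.Forces z A ∅ (W z) (G.Wins z) σ) ∧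
        ∀ v ∈ A, ∃ z, v ∈ W z := fun A hA hA' =>
    ih _ (hn ▸ Set.ncard_lt_ncard hA (Set.toFinite B)) A hA' rfl
  rcases B.eq_empty_or_nonempty with rfl | hne
  · exact ⟨fun _ => ∅, fun z => ⟨id, forces_empty _ _ _⟩, fun v h => h.elim⟩
  obtain ⟨v₀, hv₀, hc⟩ := Set.exists_max_image B G.priority (Set.toFinite B) hne
  set c := G.priority v₀ with hcdef
  set z := winnerOf c
  -- `z` is favoured by the highest priority `c`. Take a maximal winning region `W` of the other
  -- player; by maximality no attractor step extends it, so `B \ W` is again a subgame, and `z` is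
  -- shown to win all of it.
  obtain ⟨W, ⟨⟨π, hπ⟩, hWmax⟩⟩ :=
    exists_forces_maximal (P := fun W => ∃ σ, G.Forces z.other B ∅ W (G.Wins z.other) σ)
      ⟨∅, id, forces_empty _ _ _⟩
  have hleave : ∀ v ∈ B \ W, G.owner v = z.other → ∀ w ∈ W, ¬ G.edge v w := by
    intro v hv ho w hw he
    obtain ⟨σ', hσ'⟩ := hπ.insert (hΦ _) hv.1 hv.2 (fun _ => ⟨w, hw, he⟩)
      (fun h => absurd ho h)
    exact hv.2 (hWmax ⟨σ', hσ'⟩ (Set.subset_insert _ _) (Set.mem_insert _ _))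
  have hsucc : ∀ v ∈ B \ W, ∃ w ∈ B \ W, G.edge v w := by
    intro v hv
    by_contra hcon
    push Not at hcon
    by_cases ho : G.owner v = z.other
    · obtain ⟨w, hw, he⟩ := hB v hv.1
      exact hcon w ⟨hw, fun hwW => hleave v hv ho w hwW he⟩ he
    · obtain ⟨σ', hσ'⟩ := hπ.insert (hΦ _) hv.1 hv.2 (fun h => absurd h ho)
        (fun _ w hw he => by_contra fun hwW => hcon w ⟨hw, hwW⟩ he)
      exact hv.2 (hWmax ⟨σ', hσ'⟩ (Set.subset_insert _ _) (Set.mem_insert _ _))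
  suffices hz : ∃ σ, G.Forces z (B \ W) ∅ (B \ W) (G.Wins z) σ by
    obtain ⟨σ, hσ⟩ := hz
    refine ⟨fun y => if y = z then B \ W else W, fun y => ?_, fun v hv => ?_⟩
    · rcases y.eq_or_eq_other z with rfl | rfl
      · refine ⟨σ, ?_⟩
        beta_reduce
        rw [if_pos rfl]
        refine hσ.mono_subgame Set.sdiff_subset fun v hv ho w hw he =>
          ⟨hw, fun hwW => hleave v hv (Player.ne_iff.1 ho) w hwW he⟩
      · refine ⟨π, ?_⟩
        beta_reduce
        rw [if_neg z.other_ne]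
        exact hπ
    · by_cases hvW : v ∈ W
      · exact ⟨z.other, by beta_reduce; rwa [if_neg z.other_ne]⟩
      · exact ⟨z, by beta_reduce; rw [if_pos rfl]; exact ⟨hv, hvW⟩⟩
  -- The induction hypothesis needs a smaller subgame. If `W` is empty, remove the attractor `T` of
  -- the vertices of priority `c`; a region of the opponent outside `T` would also be one in `B`, so
  -- there is none. If `W` is nonempty, remove `W`; a region of the opponent in the rest could be
  -- joined to `W`.
  rcases W.eq_empty_or_nonempty with rfl | hWne
  · rw [Set.sdiff_empty]
    set N := {v | v ∈ B ∧ G.priority v = c}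
    have hNB : N ⊆ B := fun v hv => hv.1
    obtain ⟨T, ⟨⟨hNT, τ, hτ⟩, hTmax⟩⟩ := exists_forces_maximal
      (P := fun T => N ⊆ T ∧ ∃ σ, G.Forces z B N T (fun _ => False) σ)
      ⟨N, subset_rfl, id, forces_self z hNB _⟩
    have hT : ∀ v ∈ B \ T, G.owner v = z → ∀ w ∈ T, ¬ G.edge v w := by
      intro v hv ho w hw he
      obtain ⟨σ', hσ'⟩ := hτ.insert (fun _ _ h => h) hv.1 hv.2 (fun _ => ⟨w, hw, he⟩)
        (fun h => absurd ho h)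
      exact hv.2 (hTmax ⟨hNT.trans (Set.subset_insert _ _), σ', hσ'⟩ (Set.subset_insert _ _)
        (Set.mem_insert _ _))
    have hTsucc : ∀ v ∈ B \ T, ∃ w ∈ B \ T, G.edge v w := by
      intro v hv
      by_contra hcon
      push Not at hcon
      by_cases ho : G.owner v = z
      · obtain ⟨w, hw, he⟩ := hB v hv.1
        exact hcon w ⟨hw, fun hwW => hT v hv ho w hwW he⟩ he
      · obtain ⟨σ', hσ'⟩ := hτ.insert (fun _ _ h => h) hv.1 hv.2 (fun h => absurd h ho)
          (fun _ w hw he => by_contra fun hwW => hcon w ⟨hw, hwW⟩ he)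
        exact hv.2 (hTmax ⟨hNT.trans (Set.subset_insert _ _), σ', hσ'⟩ (Set.subset_insert _ _)
          (Set.mem_insert _ _))
    obtain ⟨U, hU, hcov⟩ := ih' (B \ T)
      ⟨Set.sdiff_subset, fun h => (h hv₀).2 (hNT ⟨hv₀, rfl⟩)⟩ hTsucc
    obtain ⟨σ₁, h₁⟩ := hU z.other
    have hempty : U z.other ⊆ ∅ := hWmax ⟨σ₁, h₁.mono_subgame Set.sdiff_subset
      fun v hv ho w hw he => ⟨hw, fun hwT =>
        hT v (h₁.subset hv) (by
          rcases (G.owner v).eq_or_eq_other z with h | h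
          · exact h
          · exact absurd h ho) w hwT he⟩⟩ (Set.empty_subset _)
    obtain ⟨σ₂, h₂⟩ := hU z
    have hUz : U z = B \ T := h₂.subset.antisymm fun v hv => by
      obtain ⟨y, hy⟩ := hcov v hv
      rcases y.eq_or_eq_other z with rfl | rfl
      · exact hy
      · exact (hempty hy).elim
    rw [hUz] at h₂
    exact Forces.of_attractor hB hc (fun v hv => hv.2) hτ rfl h₂
  · obtain ⟨U, hU, hcov⟩ := ih' (B \ W)
      ⟨Set.sdiff_subset, fun h => by
        obtain ⟨w, hw⟩ := hWne
        exact (h (hπ.subset hw)).2 hw⟩ hsucc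
    obtain ⟨σ₁, h₁⟩ := hU z.other
    have hsub : U z.other ⊆ W :=
      Set.subset_union_right.trans (hWmax (hπ.union h₁ (hΦ _)) Set.subset_union_left)
    obtain ⟨σ₂, h₂⟩ := hU z
    have hUz : U z = B \ W := h₂.subset.antisymm fun v hv => by
      obtain ⟨y, hy⟩ := hcov v hv
      rcases y.eq_or_eq_other z with rfl | rfl
      · exact hy
      · exact absurd (hsub hy) hv.2
    rw [hUz] at h₂
    exact ⟨σ₂, h₂⟩

theorem edge_move (σ : G.Strategy .even) (π : G.Strategy .odd) (v : V) :
    G.edge v (G.move σ π v) := by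
  unfold move
  split
  · next h => exact σ.2 ⟨v, h⟩
  · next h => exact π.2 ⟨v, h⟩

theorem move_even (σ : G.Strategy .even) (π : G.Strategy .odd) {v : V}
    (h : G.owner v = .even) : G.move σ π v = σ.1 ⟨v, h⟩ := by
  unfold move
  split
  · rfl
  · next h' => exact absurd (h.symm.trans h') (by simp)

theorem move_odd (σ : G.Strategy .even) (π : G.Strategy .odd) {v : V}
    (h : G.owner v = .odd) : G.move σ π v = π.1 ⟨v, h⟩ := by
  unfold move
  split
  · next h' => exact absurd (h.symm.trans h') (by simp)
  · rfl

/-- The memoryless strategy that follows `σ` on `W`. -/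
theorem Forces.exists_strategy (h : G.Forces z Set.univ ∅ W Φ σ) :
    ∃ τ : G.Strategy z, ∀ v (hv : G.owner v = z), v ∈ W → τ.1 ⟨v, hv⟩ = σ v := by
  classical
  refine ⟨⟨fun v => if v.1 ∈ W then σ v.1 else (G.exists_edge v.1).choose, fun v => ?_⟩, ?_⟩
  · beta_reduce
    split_ifs with hv
    · exact (h.own _ hv (by simp) v.2).1
    · exact (G.exists_edge v.1).choose_spec
  · intro v hv hvW
    simp [hvW]

theorem Forces.wins_of_follows {x : ℕ → V} (h : G.Forces z Set.univ ∅ W Φ σ) (hx0 : x 0 ∈ W)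
    (hx : ∀ i, G.edge (x i) (x (i + 1)) ∧ (G.owner (x i) = z → x i ∈ W → x (i + 1) = σ (x i))) :
    (∀ i, x i ∈ W) ∧ Φ x := by
  have hmem : ∀ i, x i ∈ W := by
    intro i
    induction i with
    | zero => exact hx0
    | succ i ih =>
      by_cases ho : G.owner (x i) = z
      · rw [(hx i).2 ho ih]
        exact (h.own _ ih (by simp) ho).2
      · exact h.opp _ ih (by simp) ho _ trivial (hx i).1
  exact ⟨hmem, h.plays x hmem (by simp) fun i => ⟨(hx i).1, fun ho => (hx i).2 ho (hmem i)⟩⟩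

theorem Forces.subset_winSet (h : G.Forces z Set.univ ∅ W (G.Wins z) σ) : W ⊆ G.winSet z := by
  intro v hv
  obtain ⟨τ, hτ⟩ := h.exists_strategy
  cases z
  · refine ⟨τ, fun π => (h.wins_of_follows hv fun i => ⟨edge_move _ _ _, fun ho hW => ?_⟩).2⟩
    exact (move_even τ π ho).trans (hτ _ ho hW)
  · refine ⟨τ, fun π => (h.wins_of_follows hv fun i => ⟨edge_move _ _ _, fun ho hW => ?_⟩).2⟩
    exact (move_odd π τ ho).trans (hτ _ ho hW)

theorem disjoint_winSet (G : ParityGame V d) : Disjoint (G.winSet .even) (G.winSet .odd) := by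
  rw [Set.disjoint_left]
  rintro v ⟨σ, hσ⟩ ⟨π, hπ⟩
  exact G.not_wins_even_and_odd (hσ π) (hπ σ)

/-- A partition into winning regions consists of the winning sets. -/
theorem eq_winSet_of_forces {S W' : Set V} {π : V → V}
    (h : G.Forces .even Set.univ ∅ W (G.Wins .even) σ)
    (h' : G.Forces .odd Set.univ ∅ W' (G.Wins .odd) π) (hcov : ∀ v, v ∈ W ∨ v ∈ W')
    (hWS : W ⊆ S) (hSW : Disjoint S W') : S = G.winSet .even ∧ Sᶜ = G.winSet .odd := by
  have hd := Set.disjoint_left.1 G.disjoint_winSet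
  have hd' := Set.disjoint_left.1 hSW
  have e := h.subset_winSet
  have o := h'.subset_winSet
  constructor
  · ext v
    refine ⟨fun hv => e ((hcov v).resolve_right (hd' hv)), fun hv => hWS ?_⟩
    exact (hcov v).resolve_right fun hv' => hd hv (o hv')
  · ext v
    refine ⟨fun hv => o ((hcov v).resolve_left fun h => hv (hWS h)), fun hv hvS => ?_⟩
    exact hd' hvS ((hcov v).resolve_left fun h => hd (e h) hv)

end ParityGame

/-! ### Ranks along plays with an even limit priority. -/

namespace OPM

variable {k d : ℕ}

theorem basicUpdate_top (c : Fin d) : basicUpdate (⊤ : Rank k d) c = ⊤ := rfl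

theorem lift_le_basicUpdate (r : Rank k d) (c : Fin d) : lift r c ≤ basicUpdate r c :=
  Finset.inf_le (f := fun s => basicUpdate s c) (by simp)

theorem lift_mono (c : Fin d) : Monotone fun r : Rank k d => lift r c := fun r r' h => by
  refine Finset.inf_mono fun s hs => ?_
  simp only [Finset.mem_filter, Finset.mem_univ, true_and] at hs ⊢
  exact h.trans hs

theorem exists_lift_eq (r : Rank k d) (c : Fin d) : ∃ s, r ≤ s ∧ lift r c = basicUpdate s c := by
  obtain ⟨s, hs, h⟩ := Finset.exists_mem_eq_inf (Finset.univ.filter (r ≤ ·))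
    ⟨r, by simp⟩ fun s => basicUpdate s c
  exact ⟨s, by simpa using hs, h⟩

/-- The value of a digit, where all priorities smaller than `p` are identified. -/
noncomputable def Digit.collapse (p : Fin d) (x : Digit d) : WithBot ℤ :=
  open Classical in if x.IsBelow p then ((-1 : ℤ) : WithBot ℤ) else x.value

/-- As `p` is even, the priorities below `p` form an interval of the digit order: the blank and the
odd priorities above `p` precede it, the even ones from `p` on follow it. Identifying them is
therefore monotone and loses strictness only within the interval. -/
theorem Digit.collapse_lt {p : Fin d} (hp : Even p.val) {x y : Digit d} (h : x < y)
    (hxy : ¬ (x.IsBelow p ∧ y.IsBelow p)) : x.collapse p < y.collapse p := by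
  have h' : x.value < y.value := h
  unfold Digit.collapse
  rcases x with _ | x <;> rcases y with _ | y
  · exact absurd h' (lt_irrefl _)
  · have : ¬ (Digit.blank : Digit d).IsBelow p := by rintro ⟨q, hq, _⟩; cases hq
    rw [if_neg this]
    split_ifs <;> exact WithBot.bot_lt_coe _
  · simp [Digit.value] at h'
  · have hx : (Digit.prio x).IsBelow p ↔ x < p :=
      ⟨by rintro ⟨q, hq, h⟩; cases hq; exact h, fun h => ⟨x, rfl, h⟩⟩
    have hy : (Digit.prio y).IsBelow p ↔ y < p :=
      ⟨by rintro ⟨q, hq, h⟩; cases hq; exact h, fun h => ⟨y, rfl, h⟩⟩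
    rw [hx, hy] at hxy
    simp only [hx, hy]
    simp only [Digit.value, WithBot.coe_lt_coe] at h' ⊢
    obtain ⟨a, ha⟩ := hp
    rw [Fin.lt_def, Fin.lt_def] at hxy
    simp only [Fin.lt_def]
    split_ifs at h' ⊢ <;> rw [WithBot.coe_lt_coe] <;> simp only [Nat.even_iff] at * <;> omega

open Classical in
/-- The digits up to the first priority smaller than `p`, where these priorities are identified. -/
noncomputable def collapse (p : Fin d) (b : Fin k → Digit d) : Lex (Fin k → WithBot ℤ) :=
  toLex fun i => if ∃ j, j < i ∧ (b j).IsBelow p then ⊥ else (b i).collapse p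

theorem collapse_eq {p : Fin d} {b b' : Fin k → Digit d} {j : Fin k}
    (hlt : ∀ i, i < j → b i = b' i) (hj : ∃ i, i < j ∧ (b i).IsBelow p) :
    collapse p b = collapse p b' := by
  have hj' : ∃ i, i < j ∧ (b' i).IsBelow p := by
    obtain ⟨i, hi, h⟩ := hj
    exact ⟨i, hi, hlt i hi ▸ h⟩
  refine congrArg toLex (funext fun i => ?_)
  by_cases hij : i < j
  · have : (∃ l, l < i ∧ (b l).IsBelow p) ↔ ∃ l, l < i ∧ (b' l).IsBelow p :=
      exists_congr fun l => and_congr_right fun hl => by rw [hlt l (hl.trans hij)]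
    classical exact if_congr this rfl (by rw [hlt i hij])
  · obtain ⟨l, hl, h⟩ := hj
    obtain ⟨l', hl', h'⟩ := hj'
    rw [if_pos ⟨l, hl.trans_le (not_lt.1 hij), h⟩, if_pos ⟨l', hl'.trans_le (not_lt.1 hij), h'⟩]

theorem collapse_eq_of_isBelow {p : Fin d} {b b' : Fin k → Digit d} {j : Fin k}
    (hlt : ∀ i, i < j → b i = b' i) (h : (b j).IsBelow p) (h' : (b' j).IsBelow p) :
    collapse p b = collapse p b' := by
  refine congrArg toLex (funext fun i => ?_)
  rcases lt_trichotomy i j with hij | rfl | hij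
  · have : (∃ l, l < i ∧ (b l).IsBelow p) ↔ ∃ l, l < i ∧ (b' l).IsBelow p :=
      exists_congr fun l => and_congr_right fun hl => by rw [hlt l (hl.trans hij)]
    classical exact if_congr this rfl (by rw [hlt i hij])
  · have : (∃ l, l < i ∧ (b l).IsBelow p) ↔ ∃ l, l < i ∧ (b' l).IsBelow p :=
      exists_congr fun l => and_congr_right fun hl => by rw [hlt l hl]
    classical exact if_congr this rfl (by rw [Digit.collapse, Digit.collapse, if_pos h, if_pos h'])
  · rw [if_pos ⟨j, hij, h⟩, if_pos ⟨j, hij, h'⟩]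

theorem collapse_lt {p : Fin d} (hp : Even p.val) {b b' : Fin k → Digit d} {j : Fin k}
    (hlt : ∀ i, i < j → b i = b' i) (hj : ∀ i, i < j → ¬ (b i).IsBelow p) (h : b j < b' j)
    (hb : ¬ ((b j).IsBelow p ∧ (b' j).IsBelow p)) : collapse p b < collapse p b' := by
  refine ⟨j, fun i hi => ?_, ?_⟩
  · have h1 : ¬ ∃ l, l < i ∧ (b l).IsBelow p := fun ⟨l, hl, h⟩ => hj l (hl.trans hi) h
    have h2 : ¬ ∃ l, l < i ∧ (b' l).IsBelow p := fun ⟨l, hl, h⟩ =>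
      hj l (hl.trans hi) (hlt l (hl.trans hi) ▸ h)
    exact (if_neg h1).trans ((congrArg _ (hlt i hi)).trans (if_neg h2).symm)
  · have h1 : ¬ ∃ l, l < j ∧ (b l).IsBelow p := fun ⟨l, hl, h⟩ => hj l hl h
    have h2 : ¬ ∃ l, l < j ∧ (b' l).IsBelow p := fun ⟨l, hl, h⟩ => hj l hl (hlt l hl ▸ h)
    exact (if_neg h1).trans_lt ((Digit.collapse_lt hp h hb).trans_eq (if_neg h2).symm)

/-- Look at the first difference: it is hidden if a priority below `p` precedes it or if both digits
there are such priorities, and otherwise it decides the collapsed order as well. -/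
theorem collapse_mono {p : Fin d} (hp : Even p.val) {b b' : Lex (Fin k → Digit d)} (h : b ≤ b') :
    collapse p (ofLex b) ≤ collapse p (ofLex b') := by
  rcases h.eq_or_lt with rfl | ⟨j, hlt, hj⟩
  · exact le_rfl
  by_cases h1 : ∃ i, i < j ∧ (ofLex b i).IsBelow p
  · exact (collapse_eq (fun i hi => hlt i hi) h1).le
  push Not at h1
  by_cases h2 : (ofLex b j).IsBelow p ∧ (ofLex b' j).IsBelow p
  · exact (collapse_eq_of_isBelow (fun i hi => hlt i hi) h2.1 h2.2).le
  · exact (collapse_lt hp (fun i hi => hlt i hi) h1 hj h2).le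

theorem exists_minimal_updatable {b : Fin k → Digit d} {c : Fin d} (h : ∃ j, Updatable b c j) :
    ∃ j, Updatable b c j ∧ ∀ i, i < j → ¬ Updatable b c i := by
  obtain ⟨j, hj, hmin⟩ := wellFounded_lt.has_min {j | Updatable b c j} h
  exact ⟨j, hj, fun i hi hu => hmin i hu hi⟩

theorem exists_updatable_of_not_isEven {b : Fin k → Digit d} {c : Fin d} (hc : Even c.val)
    (h : ¬ ∀ i, (b i).IsEven) : ∃ j, Updatable b c j := by
  push Not at h
  obtain ⟨j, hj, hmax⟩ := wellFounded_gt.has_min {j | ¬ (b j).IsEven} h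
  exact ⟨j, Or.inr ⟨hc, hj, fun i hi => by_contra fun hu => hmax i hu hi⟩⟩

/-- The possible results of a basic update. -/
theorem witnessUpdate_cases (b : Witness k d) (c : Fin d) :
    (Even c.val ∧ (∀ i, (ofLex b.1 i).IsEven) ∧ witnessUpdate b c = ⊤) ∨
    (∃ (b' : Witness k d) (j : Fin k), witnessUpdate b c = (b' : Rank k d) ∧
      Updatable (ofLex b.1) c j ∧ (∀ i, i < j → ¬ Updatable (ofLex b.1) c i) ∧
      ofLex b'.1 = write (ofLex b.1) c j) ∨
    (witnessUpdate b c = (b : Rank k d) ∧ (∀ j, ¬ Updatable (ofLex b.1) c j) ∧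
      ¬ (Even c.val ∧ ∀ i, (ofLex b.1 i).IsEven)) := by
  unfold witnessUpdate
  by_cases h1 : Even c.val ∧ ∀ i, (ofLex b.1 i).IsEven
  · exact Or.inl ⟨h1.1, h1.2, if_pos h1⟩
  · rw [if_neg h1]
    by_cases h2 : ∃ j, Updatable (ofLex b.1) c j ∧ ∀ i, i < j → ¬ Updatable (ofLex b.1) c i
    · rw [dif_pos h2]
      exact Or.inr (Or.inl ⟨_, h2.choose, rfl, h2.choose_spec.1, h2.choose_spec.2, rfl⟩)
    · rw [dif_neg h2]
      exact Or.inr (Or.inr ⟨rfl, fun j hj => h2 (exists_minimal_updatable ⟨j, hj⟩), h1⟩)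

theorem write_of_lt {b : Fin k → Digit d} {c : Fin d} {i j : Fin k} (h : i < j) :
    write b c j i = b i := if_pos h

theorem write_self {b : Fin k → Digit d} {c : Fin d} {j : Fin k} :
    write b c j j = .prio c := by simp [write]

theorem write_of_gt {b : Fin k → Digit d} {c : Fin d} {i j : Fin k} (h : j < i) :
    write b c j i = .blank := by simp [write, h.not_gt, h.ne']

theorem Digit.isBelow_prio {c p : Fin d} : (Digit.prio c).IsBelow p ↔ c < p :=
  ⟨by rintro ⟨q, hq, h⟩; cases hq; exact h, fun h => ⟨c, rfl, h⟩⟩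

theorem Digit.lt_prio_of_not_isEven {c : Fin d} (hc : Even c.val) {x : Digit d}
    (hx : ¬ x.IsEven) : x < .prio c := by
  change Digit.value _ < Digit.value _
  rcases x with _ | x
  · exact WithBot.bot_lt_coe _
  · have hx' : ¬ Even x.val := fun h => hx ⟨x, rfl, h⟩
    simp only [Digit.value, if_pos hc, if_neg hx']
    rw [WithBot.coe_lt_coe]
    rw [Nat.not_even_iff_odd] at hx'
    have := hx'.pos
    omega

theorem Digit.lt_prio_of_isBelow {c : Fin d} (hc : Even c.val) {x : Digit d}
    (hx : x.IsBelow c) : x < .prio c := by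
  obtain ⟨q, rfl, hq⟩ := hx
  change Digit.value _ < Digit.value _
  simp only [Digit.value, if_pos hc]
  rw [WithBot.coe_lt_coe]
  rw [Fin.lt_def] at hq
  split_ifs <;> omega

/-- If `c < p`, the written position either shows a change that `collapse` hides, or holds a digit
that is not even and grows by becoming even. If `c = p`, no earlier position holds a priority below
`p`, for it would have been updatable, so the growth at the written position is visible. Since `p`
is even, some position is updatable whenever the result is not `⊤`. -/
theorem collapse_le_of_witnessUpdate {p : Fin d} (hp : Even p.val) {c : Fin d} (hc : c ≤ p)
    {b b' : Witness k d} (h : witnessUpdate b c = (b' : Rank k d)) :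
    collapse p (ofLex b.1) ≤ collapse p (ofLex b'.1) ∧
      (c = p → collapse p (ofLex b.1) < collapse p (ofLex b'.1)) := by
  rcases witnessUpdate_cases b c with ⟨_, _, h'⟩ | ⟨b'', j, h', hu, hmin, hw⟩ | ⟨h', hu, hne⟩
  · rw [h] at h'
    exact absurd h' (WithTop.coe_ne_top)
  · obtain rfl : b'' = b' := WithTop.coe_injective (h'.symm.trans h)
    rw [hw]
    have hlt : ∀ i, i < j → ofLex b.1 i = write (ofLex b.1) c j i := fun i hi =>
      (write_of_lt hi).symm
    rcases hc.eq_or_lt with rfl | hcp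
    · have : collapse c (ofLex b.1) < collapse c (write (ofLex b.1) c j) := by
        refine collapse_lt hp hlt (fun i hi hb => hmin i hi (Or.inl hb)) ?_ fun hb => ?_
        · rw [write_self]
          rcases hu with hu | ⟨_, hu, _⟩
          · exact Digit.lt_prio_of_isBelow hp hu
          · exact Digit.lt_prio_of_not_isEven hp hu
        · rw [write_self, Digit.isBelow_prio] at hb
          exact lt_irrefl _ hb.2
      exact ⟨this.le, fun _ => this⟩
    · refine ⟨?_, fun h => absurd h hcp.ne⟩
      by_cases h1 : ∃ i, i < j ∧ (ofLex b.1 i).IsBelow p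
      · exact (collapse_eq hlt h1).le
      · push Not at h1
        have hsmall : (write (ofLex b.1) c j j).IsBelow p := by
          rw [write_self, Digit.isBelow_prio]
          exact hcp
        by_cases h2 : (ofLex b.1 j).IsBelow p
        · exact (collapse_eq_of_isBelow hlt h2 hsmall).le
        · rcases hu with ⟨q, hq, hqc⟩ | ⟨he, hu, _⟩
          · exact absurd ⟨q, hq, hqc.trans hcp⟩ h2
          · refine (collapse_lt hp hlt h1 ?_ fun hb => h2 hb.1).le
            rw [write_self]
            exact Digit.lt_prio_of_not_isEven he hu
  · obtain rfl : b = b' := WithTop.coe_injective (h'.symm.trans h)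
    refine ⟨le_rfl, ?_⟩
    rintro rfl
    exact absurd (exists_updatable_of_not_isEven hp fun h => hne ⟨hp, h⟩) (by simpa using hu)

theorem collapse_le_of_lift {p : Fin d} (hp : Even p.val) {c : Fin d} (hc : c ≤ p)
    {b b' : Witness k d} (h : lift (b : Rank k d) c ≤ (b' : Rank k d)) :
    collapse p (ofLex b.1) ≤ collapse p (ofLex b'.1) ∧
      (c = p → collapse p (ofLex b.1) < collapse p (ofLex b'.1)) := by
  obtain ⟨s, hs, hl⟩ := exists_lift_eq (b : Rank k d) c
  rw [hl] at h
  have hne := (h.trans_lt (WithTop.coe_lt_top b')).ne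
  obtain ⟨s, rfl⟩ := WithTop.ne_top_iff_exists.1
    (show s ≠ ⊤ by rintro rfl; exact hne (basicUpdate_top c))
  obtain ⟨t, ht⟩ := WithTop.ne_top_iff_exists.1 hne
  rw [← ht] at h
  have h1 := collapse_mono hp (b := b.1) (b' := s.1) (WithTop.coe_le_coe (a := s) (b := b) |>.1 hs)
  have h2 := collapse_le_of_witnessUpdate hp hc ht.symm
  have h3 := collapse_mono hp (b := t.1) (b' := b'.1) (WithTop.coe_le_coe (a := b') (b := t) |>.1 h)
  exact ⟨h1.trans (h2.1.trans h3), fun e => h1.trans_lt ((h2.2 e).trans_le h3)⟩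

/-- Along a play that player `𝓔` wins, ranks below `⊤` cannot be consistent with `lift`. -/
theorem not_even_isGreatest_of_lift_le (b : ℕ → Witness k d) (c : ℕ → Fin d) (p : Fin d)
    (h : ∀ i, lift (b (i + 1) : Rank k d) (c i) ≤ (b i : Rank k d)) (hp : Even p.val)
    (hc : IsGreatest {c' | ∃ᶠ i in Filter.atTop, c i = c'} p) : False := by
  -- From some time on no priority above `p` is read, so the collapsed ranks never increase again.
  obtain ⟨m, hm⟩ : ∃ m, ∀ i ≥ m, c i ≤ p := by
    rw [← Filter.eventually_atTop]
    have : ∀ᶠ i in Filter.atTop, ∀ c', p < c' → c i ≠ c' := by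
      rw [Filter.eventually_all]
      intro c'
      by_cases hpc : p < c'
      · by_contra hcon
        refine hpc.not_ge (hc.2 ?_)
        exact (Filter.not_eventually.1 hcon).mono fun i hi => by
          push Not at hi
          exact hi.2
      · exact Filter.Eventually.of_forall fun i h => absurd h hpc
    exact this.mono fun i hi => not_lt.1 fun h => hi _ h rfl
  have hstep : ∀ i ≥ m, _ := fun i hi => collapse_le_of_lift hp (hm i hi) (h i)
  have hanti : ∀ i, ∀ j ≥ m, collapse p (ofLex (b (j + i)).1) ≤ collapse p (ofLex (b j).1) := by
    intro i j hj
    induction i with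
    | zero => exact le_rfl
    | succ i ih => exact (hstep (j + i) (by omega)).1.trans ih
  have hfin : (Set.range fun i => collapse p (ofLex (b (i + m)).1)).Finite :=
    (Set.finite_range fun b : Witness k d => collapse p (ofLex b.1)).subset (by
      rintro _ ⟨i, rfl⟩
      exact ⟨_, rfl⟩)
  -- Only finitely many collapsed values exist; the first step reading `p` after a minimal one would
  -- undercut it.
  obtain ⟨_, ⟨i, rfl⟩, hmin⟩ := hfin.exists_minimal (Set.range_nonempty _)
  obtain ⟨l, hl, hlc⟩ := Filter.frequently_atTop.1 hc.1 (i + m)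
  have h1 := hanti (l - (i + m)) (i + m) (by omega)
  rw [Nat.add_sub_cancel' hl] at h1
  have h2 := ((hstep l (by omega)).2 hlc).trans_le h1
  exact h2.not_ge (hmin ⟨l + 1 - m, by
    dsimp only
    rw [Nat.sub_add_cancel (by omega)]⟩ h2.le)

end OPM

/-! ### Chains of times that justify the digits of a rank. -/

namespace OPM

variable {k d : ℕ} {c : ℕ → Fin d}

/-- The highest priority read at the times `s, …, e` is even. -/
def EvenBetween (c : ℕ → Fin d) (s e : ℕ) : Prop :=
  ∃ p, Even p.val ∧ (∃ u, s ≤ u ∧ u ≤ e ∧ c u = p) ∧ ∀ u, s ≤ u → u ≤ e → c u ≤ p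

/-- The highest priority read at the times `s, …, t - 1` is `p`. -/
def MaxBetween (c : ℕ → Fin d) (s t : ℕ) (p : Fin d) : Prop :=
  (∃ u, s ≤ u ∧ u < t ∧ c u = p) ∧ ∀ u, s ≤ u → u < t → c u ≤ p

/-- A set of `N` times from `s` to `e`, any two of which enclose an even highest priority. -/
def EvenChain (c : ℕ → Fin d) (N s e : ℕ) : Prop :=
  ∃ F : Finset ℕ, F.card = N ∧ (∀ u ∈ F, s ≤ u ∧ u ≤ e) ∧ s ∈ F ∧ e ∈ F ∧
    ∀ u ∈ F, ∀ v ∈ F, u < v → EvenBetween c u v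

theorem EvenBetween.trans {s m e : ℕ} (h : EvenBetween c s m) (h' : EvenBetween c m e) :
    EvenBetween c s e := by
  obtain ⟨p, hp, ⟨u, hu1, hu2, hu⟩, hle⟩ := h
  obtain ⟨q, hq, ⟨v, hv1, hv2, hv⟩, hle'⟩ := h'
  rcases le_total p q with hpq | hpq
  · refine ⟨q, hq, ⟨v, by omega, hv2, hv⟩, fun w h1 h2 => ?_⟩
    rcases le_total w m with h | h
    · exact (hle w h1 h).trans hpq
    · exact hle' w h h2
  · refine ⟨p, hp, ⟨u, hu1, by omega, hu⟩, fun w h1 h2 => ?_⟩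
    rcases le_total w m with h | h
    · exact hle w h1 h
    · exact (hle' w h h2).trans hpq

theorem evenChain_one (c : ℕ → Fin d) (s : ℕ) : EvenChain c 1 s s :=
  ⟨{s}, by simp, by simp, by simp, by simp, by
    simp only [Finset.mem_singleton]
    rintro u rfl v rfl h
    exact absurd h (lt_irrefl _)⟩

/-- A pair with one time in each part is linked through `e` and `s'` by transitivity of
`EvenBetween`. -/
theorem EvenChain.append {M N s e s' e' : ℕ} (h : EvenChain c M s e) (hlt : e < s')
    (hb : EvenBetween c e s') (h' : EvenChain c N s' e') : EvenChain c (M + N) s e' := by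
  obtain ⟨F, hF, hFb, hs, he, hc⟩ := h
  obtain ⟨F', hF', hFb', hs', he', hc'⟩ := h'
  have hse := (hFb e he).1
  have hse' := (hFb' e' he').1
  refine ⟨F ∪ F', ?_, ?_, by simp [hs], by simp [he'], ?_⟩
  · rw [Finset.card_union_of_disjoint, hF, hF']
    refine Finset.disjoint_left.2 fun u hu hu' => ?_
    have := (hFb u hu).2
    have := (hFb' u hu').1
    omega
  · intro u hu
    rcases Finset.mem_union.1 hu with hu | hu
    · have := hFb u hu
      omega
    · have := hFb' u hu
      omega
  · intro u hu v hv huv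
    rcases Finset.mem_union.1 hu with hu | hu <;> rcases Finset.mem_union.1 hv with hv | hv
    · exact hc u hu v hv huv
    · have h1 : EvenBetween c u s' := by
        rcases (hFb u hu).2.eq_or_lt with h | h
        · rwa [h]
        · exact (hc u hu e he h).trans hb
      rcases (hFb' v hv).1.eq_or_lt with h | h
      · rwa [← h]
      · exact h1.trans (hc' s' hs' v hv h)
    · have := (hFb v hv).2
      have := (hFb' u hu).1
      omega
    · exact hc' u hu v hv huv

/-- The digits of `b` are justified by chains in the priorities read before time `t`: the digit at
position `j` stands for a chain of `2 ^ (k - 1 - j)` times from `s j` to `e j`. -/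
def JustifiedBy (c : ℕ → Fin d) (b : Fin k → Digit d) (t : ℕ) (s e : Fin k → ℕ) : Prop :=
  ∀ j p, b j = .prio p → s j ≤ e j ∧ e j < t ∧ EvenChain c (2 ^ (k - 1 - j.val)) (s j) (e j) ∧
    MaxBetween c (e j) t p ∧ ∀ i, i < j → ∀ q, b i = .prio q → MaxBetween c (e i) (s j) q

theorem MaxBetween.succ {s t : ℕ} {p : Fin d} (h : MaxBetween c s t p) (ht : c t ≤ p) :
    MaxBetween c s (t + 1) p := by
  obtain ⟨⟨u, h1, h2, h3⟩, hle⟩ := h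
  refine ⟨⟨u, h1, by omega, h3⟩, fun v hv hv' => ?_⟩
  rcases (Nat.lt_succ_iff.1 hv').eq_or_lt with rfl | hlt
  · exact ht
  · exact hle v hv hlt

/-- The carry of a binary counter: starting from the single time `t`, the chains of the even digits
are prepended from the least significant one upwards, giving `1 + 1 + 2 + ⋯ + 2 ^ (r - 1) = 2 ^ r`
times. The maximum between consecutive chains is the digit of the earlier one, hence even; before
`t` itself it may also be the even priority `c t`. -/
theorem JustifiedBy.evenChain {b : Fin k → Digit d} {t : ℕ} {s e : Fin k → ℕ}
    (h : JustifiedBy c b t s e) (hc : Even (c t).val) (r m : ℕ) (hm : m + r = k)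
    (hev : ∀ i : Fin k, m ≤ i.val → (b i).IsEven) :
    EvenChain c (2 ^ r) (if hmk : m < k then s ⟨m, hmk⟩ else t) t := by
  induction r generalizing m with
  | zero =>
    rw [dif_neg (by omega)]
    exact evenChain_one c t
  | succ r ih =>
    have hmk : m < k := by omega
    rw [dif_pos hmk]
    obtain ⟨p, hbp, hp⟩ := hev ⟨m, hmk⟩ le_rfl
    obtain ⟨-, het, hch, hmax, -⟩ := h _ _ hbp
    have ih' := ih (m + 1) (by omega) fun i hi => hev i (by omega)
    have h2 : 2 ^ (r + 1) = 2 ^ (k - 1 - m) + 2 ^ r := by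
      rw [show k - 1 - m = r by omega]
      ring
    rw [h2]
    by_cases hm1 : m + 1 < k
    · rw [dif_pos hm1] at ih'
      obtain ⟨q, hbq, hq⟩ := hev ⟨m + 1, hm1⟩ (Nat.le_succ m)
      obtain ⟨hse, het', -, -, hprev⟩ := h _ _ hbq
      have hmax' := hprev ⟨m, hmk⟩ (Fin.mk_lt_mk.2 (Nat.lt_succ_self m)) _ hbp
      obtain ⟨⟨u, hu1, hu2, hu⟩, -⟩ := hmax'
      refine hch.append (hu1.trans_lt hu2) ⟨p, hp, ⟨u, hu1, hu2.le, hu⟩, fun v h1 h2 => ?_⟩ ih'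
      exact hmax.2 v h1 (by omega)
    · rw [dif_neg hm1] at ih'
      refine hch.append het ?_ ih'
      obtain ⟨⟨u, hu1, hu2, hu⟩, hle⟩ := hmax
      rcases le_total p (c t) with hpt | hpt
      · refine ⟨c t, hc, ⟨t, het.le, le_rfl, rfl⟩, fun v h1 h2 => ?_⟩
        rcases h2.eq_or_lt with rfl | h2
        · exact le_rfl
        · exact (hle v h1 h2).trans hpt
      · refine ⟨p, hp, ⟨u, hu1, hu2.le, hu⟩, fun v h1 h2 => ?_⟩
        rcases h2.eq_or_lt with rfl | h2
        · exact hpt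
        · exact hle v h1 h2

theorem le_of_not_updatable {b : Fin k → Digit d} {x p : Fin d} {j : Fin k}
    (h : ¬ Updatable b x j) (hb : b j = .prio p) : x ≤ p :=
  not_lt.1 fun hlt => h (Or.inl ⟨p, hb, hlt⟩)

/-- Less significant positions become blank and need no justification. More significant ones are not
updatable, so their priorities are at least `c t` and remain the maxima since the ends of their
chains. -/
theorem JustifiedBy.write {b : Fin k → Digit d} {t : ℕ} {s e : Fin k → ℕ}
    (h : JustifiedBy c b t s e) {j : Fin k} (hj : ∀ i, i < j → ¬ Updatable b (c t) i)
    {s₀ e₀ : ℕ} (hse : s₀ ≤ e₀) (het : e₀ ≤ t) (hch : EvenChain c (2 ^ (k - 1 - j.val)) s₀ e₀)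
    (hmax : ∀ u, e₀ ≤ u → u < t → c u ≤ c t)
    (hprev : ∀ i, i < j → ∀ q, b i = .prio q → MaxBetween c (e i) s₀ q) :
    JustifiedBy c (OPM.write b (c t) j) (t + 1) (Function.update s j s₀)
      (Function.update e j e₀) := by
  intro i p hp
  rcases lt_trichotomy i j with hij | rfl | hij
  · rw [write_of_lt hij] at hp
    obtain ⟨h1, h2, h3, h4, h5⟩ := h i p hp
    rw [Function.update_of_ne hij.ne, Function.update_of_ne hij.ne]
    refine ⟨h1, by omega, h3, h4.succ (le_of_not_updatable (hj i hij) hp), fun l hl q hq => ?_⟩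
    rw [write_of_lt (hl.trans hij)] at hq
    rw [Function.update_of_ne (hl.trans hij).ne]
    exact h5 l hl q hq
  · rw [write_self] at hp
    cases hp
    rw [Function.update_self, Function.update_self]
    refine ⟨hse, by omega, hch, ⟨⟨t, het, by omega, rfl⟩, fun u h1 h2 => ?_⟩, fun l hl q hq => ?_⟩
    · rcases (Nat.lt_succ_iff.1 h2).eq_or_lt with rfl | hlt
      · exact le_rfl
      · exact hmax u h1 hlt
    · rw [write_of_lt hl] at hq
      rw [Function.update_of_ne hl.ne]
      exact hprev l hl q hq
  · rw [write_of_gt hij] at hp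
    cases hp

/-- Overwriting a smaller priority keeps its chain. Overwriting a digit because of the even digits
after it is a carry: their chains and the time `t` merge into one chain of exactly the required
length. -/
theorem JustifiedBy.witnessUpdate {b b' : Witness k d} {t : ℕ} {s e : Fin k → ℕ}
    (h : JustifiedBy c (ofLex b.1) t s e) (hb : witnessUpdate b (c t) = (b' : Rank k d)) :
    ∃ s e, JustifiedBy c (ofLex b'.1) (t + 1) s e := by
  rcases witnessUpdate_cases b (c t) with ⟨_, _, h'⟩ | ⟨b'', j, h', hu, hmin, hw⟩ | ⟨h', hu, _⟩
  · rw [hb] at h'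
    exact absurd h' WithTop.coe_ne_top
  · obtain rfl : b'' = b' := WithTop.coe_injective (h'.symm.trans hb)
    rw [hw]
    rcases hu with ⟨p, hp, hlt⟩ | ⟨hc, -, hev⟩
    · obtain ⟨h1, h2, h3, h4, h5⟩ := h j p hp
      exact ⟨_, _, h.write hmin h1 h2.le h3 (fun u hu1 hu2 => (h4.2 u hu1 hu2).trans hlt.le) h5⟩
    · have hch := h.evenChain hc (k - 1 - j.val) (j.val + 1) (by omega) fun i hi => hev i hi
      by_cases hjk : j.val + 1 < k
      · rw [dif_pos hjk] at hch
        obtain ⟨q, hq, -⟩ := hev ⟨j.val + 1, hjk⟩ (Fin.lt_def.2 (Nat.lt_succ_self _))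
        obtain ⟨h1, h2, -, -, h5⟩ := h _ _ hq
        exact ⟨_, _, h.write hmin (by omega) le_rfl hch (fun u hu1 hu2 => by omega)
          fun i hi => h5 i (Fin.lt_def.2 (Nat.lt_succ_of_lt hi))⟩
      · rw [dif_neg hjk] at hch
        exact ⟨_, _, h.write hmin le_rfl le_rfl hch (fun u hu1 hu2 => by omega)
          fun i hi q hq => (h i q hq).2.2.2.1⟩
  · obtain rfl : b = b' := WithTop.coe_injective (h'.symm.trans hb)
    refine ⟨s, e, fun j p hp => ?_⟩
    obtain ⟨h1, h2, h3, h4, h5⟩ := h j p hp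
    exact ⟨h1, by omega, h3, h4.succ (le_of_not_updatable (hu j) hp), h5⟩

/-- The rank obtained from the blank witness by basic updates with the first priorities of `c`. -/
noncomputable def readRank (k : ℕ) (c : ℕ → Fin d) : ℕ → Rank k d
  | 0 => ⊥
  | t + 1 => basicUpdate (readRank k c t) (c t)

theorem readRank_congr {c c' : ℕ → Fin d} {t : ℕ} (h : ∀ i < t, c i = c' i) :
    readRank k c t = readRank k c' t := by
  induction t with
  | zero => rfl
  | succ t ih => rw [readRank, readRank, ih fun i hi => h i (by omega), h t (by omega)]

theorem exists_evenChain_or_justifiedBy (k : ℕ) (c : ℕ → Fin d) (t : ℕ) :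
    (∃ s e, e < t ∧ EvenChain c (2 ^ k) s e) ∨
      ∃ (b : Witness k d) (s e : Fin k → ℕ), readRank k c t = (b : Rank k d) ∧
        JustifiedBy c (ofLex b.1) t s e := by
  induction t with
  | zero =>
    exact Or.inr ⟨⊥, fun _ => 0, fun _ => 0, rfl, fun j p hp => by cases hp⟩
  | succ t ih =>
    rcases ih with ⟨s, e, he, h⟩ | ⟨b, s, e, hb, h⟩
    · exact Or.inl ⟨s, e, by omega, h⟩
    · have hr : readRank k c (t + 1) = witnessUpdate b (c t) := by
        rw [readRank, hb]
        rfl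
      rcases witnessUpdate_cases b (c t) with ⟨hc, hev, h'⟩ | ⟨b', _, h', _⟩ | ⟨h', _⟩
      -- The counter overflows: all `k` digits are even, so the carry from position `0` has length
      -- `2 ^ k`.
      · exact Or.inl ⟨_, t, by omega, h.evenChain hc k 0 (by omega) fun i _ => hev i⟩
      · obtain ⟨s', e', hj⟩ := h.witnessUpdate h'
        exact Or.inr ⟨b', s', e', hr.trans h', hj⟩
      · obtain ⟨s', e', hj⟩ := h.witnessUpdate h'
        exact Or.inr ⟨b, s', e', hr.trans h', hj⟩

theorem exists_evenChain_of_readRank_eq_top {t : ℕ} (h : readRank k c t = ⊤) :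
    ∃ s e, e < t ∧ EvenChain c (2 ^ k) s e := by
  rcases exists_evenChain_or_justifiedBy k c t with h' | ⟨b, _, _, hb, _⟩
  · exact h'
  · rw [h] at hb
    exact absurd hb.symm WithTop.coe_ne_top

/-! ### The number of ranks -/

theorem card_digit (d : ℕ) : Fintype.card (Digit d) = d + 1 := by
  let f : Digit d ≃ Option (Fin d) :=
    { toFun := fun x => match x with
        | .blank => none
        | .prio p => some p
      invFun := fun x => match x with
        | none => .blank
        | some p => .prio p
      left_inv := by rintro (_ | _) <;> rfl
      right_inv := by rintro (_ | _) <;> rfl }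
  rw [Fintype.card_congr f]
  simp

theorem card_rank (k d : ℕ) : Fintype.card (Rank k d) = Fintype.card (Witness k d) + 1 :=
  Fintype.card_option

theorem card_witness_le_pow (k d : ℕ) : Fintype.card (Witness k d) ≤ (d + 1) ^ k := by
  have := Fintype.card_le_of_injective (fun b : Witness k d => ofLex b.1)
    fun a b h => Subtype.ext h
  simpa [card_digit] using this

/-- The positions that hold a priority. -/
def Witness.support (b : Witness k d) : Set (Fin k) := {i | ∃ p, ofLex b.1 i = .prio p}

/-- The priority at a position of the support. -/
noncomputable def Witness.prio (b : Witness k d) (i : b.support) : Fin d := i.2.choose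

theorem Witness.prio_spec (b : Witness k d) (i : b.support) :
    ofLex b.1 i = .prio (b.prio i) := i.2.choose_spec

/-- A strictly increasing encoding of the weakly decreasing sequence of the priorities. -/
noncomputable def Witness.code (b : Witness k d) (i : b.support) : Fin (k + d) :=
  ⟨i.1.val + (d - 1 - (b.prio i).val), by omega⟩

theorem Witness.code_strictMono (b : Witness k d) : StrictMono b.code := fun i j hij => by
  have h : (b.prio j).val ≤ (b.prio i).val :=
    b.2 i j hij _ _ (b.prio_spec i) (b.prio_spec j)
  have hij' : i.1.val < j.1.val := hij
  rw [Fin.lt_def]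
  simp only [Witness.code]
  omega

/-- A witness is determined by its support and the range of `code`: strictly monotone maps on the
same linear order with the same range agree, and position and code together recover the priority. -/
theorem card_witness_le_two_pow (k d : ℕ) :
    Fintype.card (Witness k d) ≤ 2 ^ k * 2 ^ (k + d) := by
  classical
  have hinj : Function.Injective
      fun b : Witness k d => (b.support, (Set.range b.code : Set (Fin (k + d)))) := by
    intro a b hab
    obtain ⟨h1, h2⟩ := Prod.mk.inj hab
    have hcode : ∀ i (ha : i ∈ a.support) (hb : i ∈ b.support), a.code ⟨i, ha⟩ = b.code ⟨i, hb⟩ := by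
      have : ∀ (A B : Set (Fin k)) (f : A → Fin (k + d)) (g : B → Fin (k + d)), A = B →
          StrictMono f → StrictMono g → Set.range f = Set.range g →
          ∀ i (ha : i ∈ A) (hb : i ∈ B), f ⟨i, ha⟩ = g ⟨i, hb⟩ := by
        rintro A _ f g rfl hf hg hr i ha hb
        rw [(hf.range_inj hg).1 hr]
      exact this _ _ _ _ h1 a.code_strictMono b.code_strictMono h2
    refine Subtype.ext (funext fun i => ?_ : ofLex a.1 = ofLex b.1)
    by_cases ha : i ∈ a.support
    · have hb : i ∈ b.support := h1 ▸ ha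
      have := congrArg Fin.val (hcode i ha hb)
      simp only [Witness.code] at this
      have h3 := (a.prio ⟨i, ha⟩).2
      have h4 := (b.prio ⟨i, hb⟩).2
      have h5 : a.prio ⟨i, ha⟩ = b.prio ⟨i, hb⟩ := Fin.ext (by omega)
      rw [a.prio_spec ⟨i, ha⟩, b.prio_spec ⟨i, hb⟩, h5]
    · have hb : i ∉ b.support := fun h => ha (h1 ▸ h)
      have : ∀ x : Digit d, (¬ ∃ p, x = .prio p) → x = .blank := by
        rintro (_ | p) h
        · rfl
        · exact absurd ⟨p, rfl⟩ h
      rw [this _ ha, this _ hb]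
  have := Fintype.card_le_of_injective _ hinj
  simpa using this

theorem card_ranks_le_pow_log {n : ℕ} (d : ℕ) (hn : 2 ≤ n) :
    Fintype.card (𝓦 n d) ≤ n ^ (3 * (1 + Nat.log 2 d)) := by
  have h1 : d + 1 ≤ 2 ^ (1 + Nat.log 2 d) := by
    have := Nat.lt_pow_succ_log_self (b := 2) (by norm_num) d
    rw [Nat.succ_eq_add_one, add_comm] at this
    omega
  have h2 : 2 ^ (Nat.log 2 n + 1) ≤ n ^ 2 := by
    have := Nat.pow_log_le_self 2 (x := n) (by omega)
    rw [pow_succ, sq]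
    exact Nat.mul_le_mul this hn
  have h3 : Fintype.card (Witness (Nat.log 2 n + 1) d) ≤ n ^ (2 * (1 + Nat.log 2 d)) := by
    refine (card_witness_le_pow _ _).trans ((Nat.pow_le_pow_left h1 _).trans ?_)
    rw [← pow_mul, mul_comm, pow_mul, pow_mul]
    exact Nat.pow_le_pow_left h2 _
  have h4 : 1 ≤ n ^ (2 * (1 + Nat.log 2 d)) := Nat.one_le_pow _ _ (by omega)
  rw [card_rank]
  calc _ ≤ n ^ (2 * (1 + Nat.log 2 d)) * 2 := by omega
    _ ≤ n ^ (2 * (1 + Nat.log 2 d)) * n ^ (1 + Nat.log 2 d) :=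
      Nat.mul_le_mul_left _ (hn.trans (Nat.le_self_pow (by omega) n))
    _ = _ := by rw [← pow_add]; congr 1; ring

theorem card_ranks_le_pow {n d : ℕ} (hn : 2 ≤ n) (hd : d ≤ Nat.log 2 n) :
    Fintype.card (𝓦 n d) ≤ n ^ 7 := by
  have h2 : 2 ^ (Nat.log 2 n + 1) ≤ n ^ 2 := by
    have := Nat.pow_log_le_self 2 (x := n) (by omega)
    rw [pow_succ, sq]
    exact Nat.mul_le_mul this hn
  have h3 : Fintype.card (Witness (Nat.log 2 n + 1) d) ≤ n ^ 6 := by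
    refine (card_witness_le_two_pow _ _).trans ?_
    -- With `k = log n + 1`, the exponent `2 * k + d` is at most `3 * k`; this is where `d ≤ log n`
    -- enters.
    calc _ ≤ (2 ^ (Nat.log 2 n + 1)) ^ 3 := by
          rw [← pow_add, ← pow_mul]
          exact Nat.pow_le_pow_right (by norm_num) (by omega)
      _ ≤ (n ^ 2) ^ 3 := Nat.pow_le_pow_left h2 _
      _ = n ^ 6 := by rw [← pow_mul]
  have h4 : 1 ≤ n ^ 6 := Nat.one_le_pow _ _ (by omega)
  rw [card_rank, pow_succ]
  nlinarith

end OPM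

/-! ### Proof rules for total correctness with costs. -/

namespace Symbolic

variable {d : ℕ} {σ R : Type} {V : Type*} [Fintype R] {G : ParityGame V d} {M : ℕ}
  {s : Config σ R V} {Q : Config σ R V → ℕ → ℕ → Prop}

/-- Total correctness: `p`, started in `s`, terminates, stores at most `M` sets simultaneously, and
its final configuration and numbers of one-step and basic operations satisfy `Q`. -/
def Runs (G : ParityGame V d) (M : ℕ) (p : Cmd d σ R) (s : Config σ R V)
    (Q : Config σ R V → ℕ → ℕ → Prop) : Prop :=
  ∃ t k, Exec G p s t k ∧ k.space ≤ M ∧ Q t k.oneStep k.basic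

theorem Runs.mono {p : Cmd d σ R} {Q' : Config σ R V → ℕ → ℕ → Prop} (h : Runs G M p s Q)
    (hQ : ∀ t a b, Q t a b → Q' t a b) : Runs G M p s Q' := by
  obtain ⟨t, k, he, hk, h⟩ := h
  exact ⟨t, k, he, hk, hQ _ _ _ h⟩

theorem runs_skip (hs : s.stored ≤ M) (hQ : Q s 0 0) : Runs G M .skip s Q :=
  ⟨_, _, .skip s, hs, hQ⟩

theorem runs_assign {f : σ → σ} (hs : s.stored ≤ M) (hQ : Q ⟨f s.loc, s.mem⟩ 0 0) :
    Runs G M (.assign f) s Q :=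
  ⟨_, _, .assign f s, hs, hQ⟩

open Classical in
-- The new memory is a separate variable `m` tied by an equation, so that it can be supplied in the
-- closed form `memory K φ P X S T`.
theorem runs_setOp {o : SetOp} {x : σ → R} {a b : σ → Operand d R} {A B : Set V}
    {m : R → Option (Set V)} (hA : (a s.loc).eval G s.mem = some A)
    (hB : (b s.loc).eval G s.mem = some B)
    (hm : Function.update s.mem (x s.loc) (some (o.apply A B)) = m) (hs : s.stored ≤ M)
    (ht : (Config.mk s.loc m).stored ≤ M) (hQ : Q ⟨s.loc, m⟩ 0 1) :
    Runs G M (.setOp o x a b) s Q :=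
  ⟨_, _, .setOp o x a b s _ A B hA hB rfl, max_le hs (hm ▸ ht), hm ▸ hQ⟩

open Classical in
theorem runs_pre {x : σ → R} {a : σ → Operand d R} {A : Set V}
    {m : R → Option (Set V)} (hA : (a s.loc).eval G s.mem = some A)
    (hm : Function.update s.mem (x s.loc) (some (G.Pre A)) = m) (hs : s.stored ≤ M)
    (ht : (Config.mk s.loc m).stored ≤ M) (hQ : Q ⟨s.loc, m⟩ 1 0) :
    Runs G M (.pre x a) s Q :=
  ⟨_, _, .pre x a s _ A hA rfl, max_le hs (hm ▸ ht), hm ▸ hQ⟩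

theorem runs_test {t : SetTest} {a b : σ → Operand d R} {f : Bool → σ → σ} {A B : Set V}
    (hA : (a s.loc).eval G s.mem = some A) (hB : (b s.loc).eval G s.mem = some B)
    (hs : s.stored ≤ M)
    (hQ : ∀ ans : Bool, (ans = true ↔ t.Holds A B) → Q ⟨f ans s.loc, s.mem⟩ 0 1) :
    Runs G M (.test t a b f) s Q :=
  ⟨_, _, .test t a b f s A B hA hB, hs, hQ _ (by simp)⟩

open Classical in
theorem runs_free {x : σ → R} {m : R → Option (Set V)}
    (hm : Function.update s.mem (x s.loc) none = m) (hs : s.stored ≤ M) (hQ : Q ⟨s.loc, m⟩ 0 0) :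
    Runs G M (.free x) s Q :=
  ⟨_, _, .free x s, hs, hm ▸ hQ⟩

theorem runs_nil (hs : s.stored ≤ M) (hQ : Q s 0 0) : Runs G M (.block []) s Q :=
  runs_skip hs hQ

/-- Nesting the remaining program in the postcondition lets a block be executed from the front while
costs accumulate. -/
theorem runs_cons {p : Cmd d σ R} {ps : List (Cmd d σ R)}
    (h : Runs G M p s fun t a b => Runs G M (.block ps) t fun u a' b' => Q u (a + a') (b + b')) :
    Runs G M (.block (p :: ps)) s Q := by
  obtain ⟨t, k, hp, hk, u, l, hq, hl, hQ⟩ := h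
  exact ⟨u, _, .seq _ _ _ _ _ _ _ hp hq, max_le hk hl, hQ⟩

theorem runs_ite {b : σ → Bool} {p q : Cmd d σ R} (hp : b s.loc = true → Runs G M p s Q)
    (hq : b s.loc = false → Runs G M q s Q) : Runs G M (.ite b p q) s Q := by
  cases hb : b s.loc
  · obtain ⟨t, k, he, h⟩ := hq hb
    exact ⟨t, k, .ite_false _ _ _ _ _ _ hb he, h⟩
  · obtain ⟨t, k, he, h⟩ := hp hb
    exact ⟨t, k, .ite_true _ _ _ _ _ _ hb he, h⟩

theorem runs_while_false {b : σ → Bool} {p : Cmd d σ R} (hb : b s.loc = false)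
    (hs : s.stored ≤ M) (hQ : Q s 0 0) : Runs G M (.while b p) s Q :=
  ⟨_, _, .while_false b p s hb, hs, hQ⟩

theorem runs_while_true {b : σ → Bool} {p : Cmd d σ R} (hb : b s.loc = true)
    (h : Runs G M p s fun t a b' => Runs G M (.while b p) t fun u a' b'' =>
      Q u (a + a') (b' + b'')) : Runs G M (.while b p) s Q := by
  obtain ⟨t, k, hp, hk, u, l, hq, hl, hQ⟩ := h
  exact ⟨u, _, .while_true _ _ _ _ _ _ _ hb hp hq, max_le hk hl, hQ⟩

end Symbolic

/-! ### The search tree: representation, size, potential and loop invariants. -/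

namespace BlackBox

open Symbolic

set_option linter.unusedSectionVars false

section Tree

variable {W : Type} [LinearOrder W] [BoundedOrder W]

/-- The largest element of `K` below `x` (`⊥` if there is none). -/
def prev (K : Finset W) (x : W) : W := (K.filter (· < x)).sup id

variable {K : Finset W} {x y : W}

theorem prev_lt (hx : ⊥ < x) : prev K x < x :=
  (Finset.sup_lt_iff hx).2 fun _ hy => (Finset.mem_filter.1 hy).2

theorem le_prev (hy : y ∈ K) (h : y < x) : y ≤ prev K x :=
  Finset.le_sup (f := id) (Finset.mem_filter.2 ⟨hy, h⟩)

theorem prev_mem (h : ∃ y ∈ K, y < x) : prev K x ∈ K := by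
  obtain ⟨y, hy, hyx⟩ := h
  obtain ⟨z, hz, he⟩ := Finset.exists_mem_eq_sup (K.filter (· < x))
    ⟨y, Finset.mem_filter.2 ⟨hy, hyx⟩⟩ id
  rw [prev, he]
  exact (Finset.mem_filter.1 hz).1

theorem prev_eq_bot (h : ¬ ∃ y ∈ K, y < x) : prev K x = ⊥ := by
  have : K.filter (· < x) = ∅ := Finset.filter_eq_empty_iff.2 fun y hy hyx => h ⟨y, hy, hyx⟩
  rw [prev, this, Finset.sup_empty]

theorem prev_mono {K' : Finset W} (h : K' ⊆ K) : prev K' x ≤ prev K x :=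
  Finset.sup_mono (Finset.filter_subset_filter _ h)

theorem prev_insert_self : prev (insert x K) x = prev K x := by
  rw [prev, prev, Finset.filter_insert, if_neg (lt_irrefl x)]

variable {V : Type*}

/-- `φ` is constant on the intervals that contain no element of `K` except for their maximum. -/
def Gap (K : Finset W) (φ : W → Set V) : Prop :=
  ∀ x y, x ≤ y → (∀ z ∈ K, x ≤ z → y ≤ z) → φ x = φ y

/-- The function `f` after `A` has been added to the sets up to `l`. -/
def raise (f : W → Set V) (A : Set V) (l : W) (x : W) : Set V := f x ∪ if x ≤ l then A else ∅

/-- The function `f` after `A` has been added to the sets above `q` and up to `l`. -/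
def raiseAbove (f : W → Set V) (A : Set V) (l q : W) (x : W) : Set V :=
  if q < x then raise f A l x else f x

variable {f : W → Set V} {A : Set V} {l p q : W}

theorem raise_of_le (h : x ≤ l) : raise f A l x = f x ∪ A := by rw [raise, if_pos h]

theorem raise_of_lt (h : l < x) : raise f A l x = f x := by
  rw [raise, if_neg h.not_ge, Set.union_empty]

theorem le_raise : f x ⊆ raise f A l x := Set.subset_union_left

theorem raise_antitone (hf : Antitone f) : Antitone (raise f A l) := fun x y hxy =>
  Set.union_subset_union (hf hxy) (by
    by_cases hy : y ≤ l
    · rw [if_pos hy, if_pos (hxy.trans hy)]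
    · rw [if_neg hy]
      exact Set.empty_subset _)

theorem raise_congr (hx : x ≤ l) (hy : y ≤ l) (h : f x = f y) :
    raise f A l x = raise f A l y := by
  rw [raise_of_le hx, raise_of_le hy, h]

theorem raiseAbove_of_lt (h : q < x) : raiseAbove f A l q x = raise f A l x := if_pos h

theorem raiseAbove_of_le (h : x ≤ q) : raiseAbove f A l q x = f x := if_neg h.not_gt

theorem raiseAbove_self : raiseAbove f A l l = f := funext fun x => by
  by_cases hx : l < x
  · rw [raiseAbove_of_lt hx, raise_of_lt hx]
  · rw [raiseAbove_of_le (not_lt.1 hx)]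

theorem raiseAbove_bot (hf : f ⊥ = Set.univ) : raiseAbove f A l ⊥ = raise f A l :=
  funext fun x => by
    rcases eq_bot_or_bot_lt x with rfl | hx
    · rw [raiseAbove_of_le le_rfl, raise, hf, Set.univ_union]
    · rw [raiseAbove_of_lt hx]

/-- Justifies leaving the inner loop: once `A` is contained in the set at `q`, it is contained in
all sets below, and raising them would change nothing. -/
theorem raiseAbove_eq_raise (hf : Antitone f) (hq : q ≤ l) (hA : A ⊆ f q) :
    raiseAbove f A l q = raise f A l := funext fun x => by
  by_cases hx : q < x
  · rw [raiseAbove_of_lt hx]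
  · rw [raiseAbove_of_le (not_lt.1 hx), raise_of_le ((not_lt.1 hx).trans hq),
      Set.union_eq_self_of_subset_right (hA.trans (hf (not_lt.1 hx)))]

theorem raiseAbove_mono (h : p ≤ q) : raiseAbove f A l q x ⊆ raiseAbove f A l p x := by
  by_cases hq : q < x
  · rw [raiseAbove_of_lt hq, raiseAbove_of_lt (h.trans_lt hq)]
  · rw [raiseAbove_of_le (not_lt.1 hq), raiseAbove]
    split_ifs
    · exact le_raise
    · exact subset_rfl

/-- All points above the previous key and up to `q` are read from the key `q`, so storing the raised
set there raises them all at once. Without a previous key, `prev` is `⊥`, where the set is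
everything anyway. -/
theorem Gap.insert (h : Gap K (raiseAbove f A l q)) (hf : f ⊥ = Set.univ) (hq : q ≤ l) :
    Gap (insert q K) (raiseAbove f A l (prev K q)) := by
  intro x y hxy hz
  have hzK : ∀ z ∈ K, x ≤ z → y ≤ z := fun z hz' => hz z (Finset.mem_insert_of_mem hz')
  have h' := h x y hxy hzK
  have hR : raise f A l x = raise f A l y := by
    by_cases hx : q < x
    · rwa [raiseAbove_of_lt hx, raiseAbove_of_lt (hx.trans_le hxy)] at h'
    · have hy := hz q (Finset.mem_insert_self _ _) (not_lt.1 hx)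
      rw [raiseAbove_of_le (not_lt.1 hx), raiseAbove_of_le hy] at h'
      exact raise_congr ((not_lt.1 hx).trans hq) (hy.trans hq) h'
  by_cases hp : ∃ z ∈ K, z < q
  · by_cases hx : prev K q < x
    · rwa [raiseAbove_of_lt hx, raiseAbove_of_lt (hx.trans_le hxy)]
    · have hy := hzK _ (prev_mem hp) (not_lt.1 hx)
      have hpq : prev K q ≤ q := Finset.sup_le fun z hz => (Finset.mem_filter.1 hz).2.le
      rw [raiseAbove_of_le (hy.trans hpq), raiseAbove_of_le (hxy.trans (hy.trans hpq))] at h'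
      rwa [raiseAbove_of_le hy, raiseAbove_of_le (hxy.trans hy)]
  · rwa [prev_eq_bot hp, raiseAbove_bot hf]

/-- The equality makes the previous key redundant: an interval that crosses it but no other key ends
at or below `q`, and antitonicity squeezes its values together. -/
theorem Gap.erase (h : Gap K (raiseAbove f A l (prev K q))) (hf : f ⊥ = Set.univ)
    (hanti : Antitone f) (hq : q ≤ l) (hqK : q ∈ K) (hp : ∃ z ∈ K, z < q)
    (he : raise f A l q = raise f A l (prev K q)) :
    Gap (K.erase (prev K q)) (raiseAbove f A l (prev (K.erase (prev K q)) q)) := by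
  intro x y hxy hz
  obtain ⟨p, hpdef⟩ : ∃ p, prev K q = p := ⟨_, rfl⟩
  have hpq : p < q := by
    obtain ⟨z, hz, hzq⟩ := hp
    exact hpdef ▸ prev_lt (bot_le.trans_lt hzq)
  have hpK : p ∈ K := hpdef ▸ prev_mem hp
  rw [hpdef] at h he hz ⊢
  have hqK' : q ∈ K.erase p := Finset.mem_erase.2 ⟨hpq.ne', hqK⟩
  have hR : raise f A l x = raise f A l y := by
    by_cases hxpy : x ≤ p ∧ p < y
    · have h1 := h x p hxpy.1 fun z hzK hxz => by
        by_cases hzp : z = p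
        · exact hzp.ge
        · exact hxpy.2.le.trans (hz z (Finset.mem_erase.2 ⟨hzp, hzK⟩) hxz)
      rw [raiseAbove_of_le hxpy.1, raiseAbove_of_le le_rfl] at h1
      have h2 : raise f A l x = raise f A l p :=
        raise_congr (hxpy.1.trans (hpq.le.trans hq)) (hpq.le.trans hq) h1
      refine le_antisymm ?_ (raise_antitone hanti hxy)
      rw [h2, ← he]
      exact raise_antitone hanti (hz q hqK' (hxpy.1.trans hpq.le))
    · have h1 := h x y hxy fun z hzK hxz => by
        by_cases hzp : z = p
        · subst hzp
          exact not_lt.1 fun h => hxpy ⟨hxz, h⟩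
        · exact hz z (Finset.mem_erase.2 ⟨hzp, hzK⟩) hxz
      by_cases hx : p < x
      · rwa [raiseAbove_of_lt hx, raiseAbove_of_lt (hx.trans_le hxy)] at h1
      · have hy : y ≤ p := not_lt.1 fun h => hxpy ⟨not_lt.1 hx, h⟩
        rw [raiseAbove_of_le (not_lt.1 hx), raiseAbove_of_le hy] at h1
        exact raise_congr (hxy.trans (hy.trans (hpq.le.trans hq))) (hy.trans (hpq.le.trans hq)) h1
  by_cases hp' : ∃ z ∈ K.erase p, z < q
  · by_cases hx : prev (K.erase p) q < x
    · rwa [raiseAbove_of_lt hx, raiseAbove_of_lt (hx.trans_le hxy)]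
    · have hy := hz _ (prev_mem hp') (not_lt.1 hx)
      have hp'p : prev (K.erase p) q ≤ p := hpdef ▸ prev_mono (Finset.erase_subset _ _)
      have h1 := h x y hxy fun z hzK hxz => by
        by_cases hzp : z = p
        · exact hzp ▸ hy.trans hp'p
        · exact hz z (Finset.mem_erase.2 ⟨hzp, hzK⟩) hxz
      rw [raiseAbove_of_le (hy.trans hp'p), raiseAbove_of_le (hxy.trans (hy.trans hp'p))] at h1
      rwa [raiseAbove_of_le hy, raiseAbove_of_le (hxy.trans hy)]
  · rwa [prev_eq_bot hp', raiseAbove_bot hf]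

theorem card_le_of_antitone [Fintype V] (hf : Antitone f)
    (h : ∀ x ∈ K, ∀ y ∈ K, x < y → f x ≠ f y) : K.card ≤ Fintype.card V + 1 := by
  have hinj : Set.InjOn (fun x => (f x).ncard) K := by
    have key : ∀ x ∈ K, ∀ y ∈ K, x < y → (f x).ncard ≠ (f y).ncard := fun x hx y hy hxy he =>
      h x hx y hy hxy (Set.eq_of_subset_of_ncard_le (hf hxy.le) he.le (Set.toFinite _)).symm
    intro x hx y hy he
    rcases lt_trichotomy x y with hxy | hxy | hxy
    · exact absurd he (key x hx y hy hxy)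
    · exact hxy
    · exact absurd he.symm (key y hy x hx hxy)
  have := Finset.card_le_card_of_injOn (t := Finset.range (Fintype.card V + 1)) _
    (fun x _ => by
      simp only [Finset.coe_range, Set.mem_Iio, Nat.lt_succ_iff]
      rw [← Nat.card_eq_fintype_card]
      exact Set.ncard_le_card _) hinj
  simpa using this

/-- During an update the keys already treated carry raised sets and the others old ones; each family
is a strict chain of subsets of `V`, hence twice `n + 1`. -/
theorem card_le_of_antitone₂ [Fintype V] {f g : W → Set V} (hf : Antitone f) (hg : Antitone g)
    (P : W → Prop) (h : ∀ x ∈ K, ∀ y ∈ K, x < y → P x → P y → f x ≠ f y)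
    (h' : ∀ x ∈ K, ∀ y ∈ K, x < y → ¬ P x → ¬ P y → g x ≠ g y) :
    K.card ≤ 2 * Fintype.card V + 2 := by
  classical
  have h1 := card_le_of_antitone (K := K.filter P) hf fun x hx y hy hxy => by
    rw [Finset.mem_filter] at hx hy
    exact h x hx.1 y hy.1 hxy hx.2 hy.2
  have h2 := card_le_of_antitone (K := K.filter fun x => ¬ P x) hg fun x hx y hy hxy => by
    rw [Finset.mem_filter] at hx hy
    exact h' x hx.1 y hy.1 hxy hx.2 hy.2
  have := Finset.card_filter_add_card_filter_not (s := K) P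
  omega

/-- The number of possible additions of vertices to the sets. -/
noncomputable def slack [Fintype W] (φ : W → Set V) : ℕ := ∑ x, (φ x)ᶜ.ncard

theorem slack_le [Fintype W] [Fintype V] (φ : W → Set V) :
    slack φ ≤ Fintype.card V * Fintype.card W := by
  have : ∀ x ∈ Finset.univ, (φ x)ᶜ.ncard ≤ Fintype.card V := fun x _ => by
    rw [← Nat.card_eq_fintype_card]
    exact Set.ncard_le_card _
  refine (Finset.sum_le_card_nsmul _ _ _ this).trans_eq ?_
  rw [Finset.card_univ, smul_eq_mul, mul_comm]

/-- The loop is entered only if `A` is not contained in the set at `q`, so that set gains a vertex.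
-/
theorem slack_raiseAbove_lt [Fintype W] [Finite V] (hpq : p < q) (hq : q ≤ l) (hA : ¬ A ⊆ f q) :
    slack (raiseAbove f A l p) < slack (raiseAbove f A l q) := by
  refine Finset.sum_lt_sum (fun x _ => Set.ncard_le_ncard
    (Set.compl_subset_compl.2 (raiseAbove_mono hpq.le)) (Set.toFinite _)) ⟨q, Finset.mem_univ _, ?_⟩
  refine Set.ncard_lt_ncard (compl_lt_compl_iff_lt.2 ?_) (Set.toFinite _)
  rw [raiseAbove_of_le le_rfl, raiseAbove_of_lt hpq, raise_of_le hq]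
  exact ⟨Set.subset_union_left, fun h => hA (Set.subset_union_right.trans h)⟩

/-- The sets `φ x` are represented by a search tree with the elements `K`. -/
structure Tree (K : Finset W) (φ : W → Set V) : Prop where
  top_mem : ⊤ ∈ K
  gap : Gap K φ
  anti : Antitone φ
  bot : φ ⊥ = Set.univ
  ne : ∀ x ∈ K, ∀ y ∈ K, x < y → φ x ≠ φ y

/-- The inactive elements were inactive elements before, and their sets have not changed. -/
def Quiet (K : Finset W) (L : List W) (φ : W → Set V) (K₀ : Finset W) (L₀ : List W)
    (φ₀ : W → Set V) : Prop :=
  ∀ x ∈ K, x ∉ L → x ∈ K₀ ∧ x ∉ L₀ ∧ φ x = φ₀ x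

theorem Quiet.trans {K₀ K₁ K₂ : Finset W} {L₀ L₁ L₂ : List W} {φ₀ φ₁ φ₂ : W → Set V}
    (h : Quiet K₂ L₂ φ₂ K₁ L₁ φ₁) (h' : Quiet K₁ L₁ φ₁ K₀ L₀ φ₀) :
    Quiet K₂ L₂ φ₂ K₀ L₀ φ₀ := fun x hx hxL => by
  obtain ⟨h1, h2, h3⟩ := h x hx hxL
  obtain ⟨h4, h5, h6⟩ := h' x h1 h2
  exact ⟨h4, h5, h3.trans h6⟩

/-- The invariant of the inner while-loop. -/
structure InnerInv (f : W → Set V) (A : Set V) (l : W) (K₀ : Finset W) (L₀ : List W)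
    (K : Finset W) (L : List W) (q : W) : Prop where
  top_mem : ⊤ ∈ K
  le : q ≤ l
  gap : Gap K (raiseAbove f A l q)
  ne_below : ∀ x ∈ K, ∀ y ∈ K, x < y → y ≤ q → f x ≠ f y
  ne_above : ∀ x ∈ K, ∀ y ∈ K, x < y → q < y → raise f A l x ≠ raise f A l y
  ne_self : ¬ A ⊆ f q → ∀ y ∈ K, q < y → raise f A l q ≠ raise f A l y
  quiet : Quiet K L (raiseAbove f A l q) K₀ L₀ f

/-- The invariant of the removal loop. -/
structure RemovalInv (f : W → Set V) (A : Set V) (l : W) (K₀ : Finset W) (L₀ : List W)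
    (K : Finset W) (L : List W) (q : W) : Prop where
  top_mem : ⊤ ∈ K
  mem : q ∈ K
  le : q ≤ l
  bot_lt : ⊥ < q
  gap : Gap K (raiseAbove f A l (prev K q))
  ne_below : ∀ x ∈ K, ∀ y ∈ K, x < y → y < q → f x ≠ f y
  ne_above : ∀ x ∈ K, ∀ y ∈ K, x < y → q ≤ x → raise f A l x ≠ raise f A l y
  quiet : Quiet K L (raiseAbove f A l (prev K q)) K₀ L₀ f

variable {K₀ : Finset W} {L₀ L : List W}

theorem Tree.innerInv (h : Tree K f) (A : Set V) (l : W) (L : List W) :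
    InnerInv f A l K L K L l where
  top_mem := h.top_mem
  le := le_rfl
  gap := by
    rw [raiseAbove_self]
    exact h.gap
  ne_below x hx y hy hxy _ := h.ne x hx y hy hxy
  ne_above x hx y hy hxy hly he := by
    rw [raise_of_lt hly] at he
    exact h.ne x hx y hy hxy ((le_raise.trans he.le).antisymm (h.anti hxy.le))
  ne_self hA y hy hly he := by
    rw [raise_of_lt hly, raise_of_le le_rfl] at he
    exact hA (Set.subset_union_right.trans (he.le.trans (h.anti hly.le)))
  quiet x hx hxL := ⟨hx, hxL, by rw [raiseAbove_self]⟩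

theorem InnerInv.tree (h : InnerInv f A l K₀ L₀ K L q) (hf : Antitone f) (hbot : f ⊥ = Set.univ)
    (hA : A ⊆ f q) : Tree K (raise f A l) where
  top_mem := h.top_mem
  gap := raiseAbove_eq_raise hf h.le hA ▸ h.gap
  anti := raise_antitone hf
  bot := by rw [raise, hbot, Set.univ_union]
  ne x hx y hy hxy := by
    by_cases hyq : y ≤ q
    · rw [← raiseAbove_eq_raise hf h.le hA, raiseAbove_of_le hyq,
        raiseAbove_of_le (hxy.le.trans hyq)]
      exact h.ne_below x hx y hy hxy hyq
    · exact h.ne_above x hx y hy hxy (not_le.1 hyq)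

theorem InnerInv.card_le [Fintype V] (h : InnerInv f A l K₀ L₀ K L q) (hf : Antitone f) :
    K.card ≤ 2 * Fintype.card V + 2 :=
  card_le_of_antitone₂ hf (raise_antitone hf) (· ≤ q)
    (fun x hx y hy hxy _ hyq => h.ne_below x hx y hy hxy hyq)
    (fun x hx y hy hxy _ hyq => h.ne_above x hx y hy hxy (not_le.1 hyq))

theorem RemovalInv.card_le [Fintype V] (h : RemovalInv f A l K₀ L₀ K L q) (hf : Antitone f) :
    K.card ≤ 2 * Fintype.card V + 2 :=
  card_le_of_antitone₂ hf (raise_antitone hf) (· < q)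
    (fun x hx y hy hxy _ hyq => h.ne_below x hx y hy hxy hyq)
    (fun x hx y hy hxy hxq _ => h.ne_above x hx y hy hxy (not_lt.1 hxq))

theorem InnerInv.bot_lt (hA : ¬ A ⊆ f q) (hbot : f ⊥ = Set.univ) : ⊥ < q :=
  bot_lt_iff_ne_bot.2 fun h => hA (by rw [h, hbot]; exact Set.subset_univ _)

theorem raiseAbove_prev_of_ne (hx : x ∈ K) (hxq : x ≠ q) (hq : ⊥ < q) :
    raiseAbove f A l (prev K q) x = raiseAbove f A l q x := by
  rcases lt_or_gt_of_ne hxq with h | h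
  · rw [raiseAbove_of_le (le_prev hx h), raiseAbove_of_le h.le]
  · rw [raiseAbove_of_lt h, raiseAbove_of_lt ((prev_lt hq).trans h)]

theorem InnerInv.removalInv (h : InnerInv f A l K₀ L₀ K L q) (hbot : f ⊥ = Set.univ)
    (hA : ¬ A ⊆ f q) {L' : List W} (hL : L ⊆ L') (hqL : q ∈ L') :
    RemovalInv f A l K₀ L₀ (insert q K) L' q where
  top_mem := Finset.mem_insert_of_mem h.top_mem
  mem := Finset.mem_insert_self _ _
  le := h.le
  bot_lt := InnerInv.bot_lt hA hbot
  gap := by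
    rw [prev_insert_self]
    exact h.gap.insert hbot h.le
  ne_below x hx y hy hxy hyq := h.ne_below x (Finset.mem_of_mem_insert_of_ne hx (hxy.trans hyq).ne)
    y (Finset.mem_of_mem_insert_of_ne hy hyq.ne) hxy hyq.le
  ne_above x hx y hy hxy hqx := by
    have hqy := hqx.trans_lt hxy
    have hy' := Finset.mem_of_mem_insert_of_ne hy hqy.ne'
    rcases hqx.eq_or_lt with rfl | hqx
    · exact h.ne_self hA y hy' hqy
    · exact h.ne_above x (Finset.mem_of_mem_insert_of_ne hx hqx.ne') y hy' hxy hqy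
  quiet x hx hxL := by
    have hxq : x ≠ q := fun e => hxL (e ▸ hqL)
    have hxK := Finset.mem_of_mem_insert_of_ne hx hxq
    rw [prev_insert_self, raiseAbove_prev_of_ne hxK hxq (InnerInv.bot_lt hA hbot)]
    exact h.quiet x hxK fun hx => hxL (hL hx)

theorem RemovalInv.raiseAbove_erase (h : RemovalInv f A l K₀ L₀ K L q)
    (hx : x ∈ K.erase (prev K q)) :
    raiseAbove f A l (prev (K.erase (prev K q)) q) x = raiseAbove f A l (prev K q) x := by
  obtain ⟨hxp, hxK⟩ := Finset.mem_erase.1 hx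
  rcases lt_or_ge x q with hxq | hxq
  · rw [raiseAbove_of_le (le_prev hx hxq), raiseAbove_of_le (le_prev hxK hxq)]
  · rw [raiseAbove_of_lt ((prev_lt h.bot_lt).trans_le hxq),
      raiseAbove_of_lt ((prev_lt h.bot_lt).trans_le hxq)]

theorem RemovalInv.erase (h : RemovalInv f A l K₀ L₀ K L q) (hf : Antitone f)
    (hbot : f ⊥ = Set.univ) (hp : ∃ z ∈ K, z < q)
    (he : raise f A l q = raise f A l (prev K q)) :
    RemovalInv f A l K₀ L₀ (K.erase (prev K q)) (L.erase (prev K q)) q where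
  top_mem := Finset.mem_erase.2 ⟨((prev_lt h.bot_lt).trans_le le_top).ne', h.top_mem⟩
  mem := Finset.mem_erase.2 ⟨(prev_lt h.bot_lt).ne', h.mem⟩
  le := h.le
  bot_lt := h.bot_lt
  gap := h.gap.erase hbot hf h.le h.mem hp he
  ne_below x hx y hy := h.ne_below x (Finset.mem_of_mem_erase hx) y (Finset.mem_of_mem_erase hy)
  ne_above x hx y hy := h.ne_above x (Finset.mem_of_mem_erase hx) y (Finset.mem_of_mem_erase hy)
  quiet x hx hxL := by
    rw [h.raiseAbove_erase hx]
    exact h.quiet x (Finset.mem_of_mem_erase hx) fun hx' =>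
      hxL ((List.mem_erase_of_ne (Finset.ne_of_mem_erase hx)).2 hx')

/-- If a key below `q` and one at or above `q` had equal raised sets, antitonicity would also equate
those at `prev K q` and `q`, and removal would not have stopped. Distinctness thus extends down to
`prev K q`. -/
theorem RemovalInv.innerInv (h : RemovalInv f A l K₀ L₀ K L q) (hf : Antitone f)
    (hbot : f ⊥ = Set.univ)
    (hne : ¬ ((∃ z ∈ K, z < q) ∧ raise f A l q = raise f A l (prev K q))) :
    InnerInv f A l K₀ L₀ K L (prev K q) := by
  have habove : ∀ x ∈ K, ∀ y ∈ K, x < y → prev K q < y → raise f A l x ≠ raise f A l y := by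
    intro x hx y hy hxy hpy he
    have hqy : q ≤ y := not_lt.1 fun hyq => hpy.not_ge (le_prev hy hyq)
    by_cases hqx : q ≤ x
    · exact h.ne_above x hx y hy hxy hqx he
    · have hxq := not_le.1 hqx
      refine hne ⟨⟨x, hx, hxq⟩, (raise_antitone hf (prev_lt h.bot_lt).le).antisymm ?_⟩
      exact (raise_antitone hf (le_prev hx hxq)).trans (he.le.trans (raise_antitone hf hqy))
  exact
    { top_mem := h.top_mem
      le := (prev_lt h.bot_lt).le.trans h.le
      gap := h.gap
      ne_below := fun x hx y hy hxy hyp =>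
        h.ne_below x hx y hy hxy (hyp.trans_lt (prev_lt h.bot_lt))
      ne_above := habove
      ne_self := fun hA y hy hpy => by
        by_cases hp : ∃ z ∈ K, z < q
        · exact habove _ (prev_mem hp) y hy hpy hpy
        · rw [prev_eq_bot hp] at hA
          exact absurd (InnerInv.bot_lt hA hbot) (lt_irrefl _)
      quiet := h.quiet }

end Tree

end BlackBox

/-! ### Execution of the algorithm and its costs. -/

namespace BlackBox

open Symbolic

set_option linter.unusedSectionVars false

variable {W : Type} [LinearOrder W] [BoundedOrder W] {d : ℕ} {V : Type*}

theorem le_ceil (s : State W) (x : W) : x ≤ ceil s x :=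
  Finset.le_inf fun _ hy => (Finset.mem_filter.1 hy).2

theorem ceil_le {s : State W} {x y : W} (hy : y ∈ s.keys) (h : x ≤ y) : ceil s x ≤ y :=
  Finset.inf_le (f := id) (Finset.mem_filter.2 ⟨hy, h⟩)

theorem ceil_mem {s : State W} (h : ⊤ ∈ s.keys) (x : W) : ceil s x ∈ s.keys := by
  obtain ⟨y, hy, he⟩ := Finset.exists_mem_eq_inf (s.keys.filter (x ≤ ·))
    ⟨⊤, Finset.mem_filter.2 ⟨h, le_top⟩⟩ id
  rw [ceil, he]
  exact (Finset.mem_filter.1 hy).1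

theorem getNext_mem {s : State W} (h : ⊤ ∈ s.keys) {x : W} (hx : x < ⊤) :
    getNext s x ∈ s.keys ∧ x < getNext s x := by
  obtain ⟨y, hy, he⟩ := Finset.exists_mem_eq_inf (s.keys.filter (x < ·))
    ⟨⊤, Finset.mem_filter.2 ⟨h, hx⟩⟩ id
  rw [getNext, he]
  exact Finset.mem_filter.1 hy

/-- The symbolic memory in which the node `x ∈ K` points to `φ x`. -/
def memory (K : Finset W) (φ : W → Set V) (P X S T : Option (Set V)) :
    Cell W → Option (Set V)
  | .node x => if x ∈ K then some (φ x) else none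
  | .P => P
  | .X => X
  | .S => S
  | .T => T

variable {K : Finset W} {φ ψ : W → Set V} {P X S T : Option (Set V)} {A B : Set V} {x : W}

theorem memory_congr (h : ∀ x ∈ K, φ x = ψ x) :
    memory K φ P X S T = memory K ψ P X S T := by
  funext c
  cases c <;> simp only [memory]
  split_ifs with hx
  · rw [h _ hx]
  · rfl

theorem update_P {inst : DecidableEq (Cell W)} :
    Function.update (memory K φ P X S T) .P (some A) = memory K φ (some A) X S T := by
  funext c
  cases c <;> simp [Function.update, memory]

theorem update_X {inst : DecidableEq (Cell W)} :
    Function.update (memory K φ P X S T) .X (some A) = memory K φ P (some A) S T := by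
  funext c
  cases c <;> simp [Function.update, memory]

theorem update_S {inst : DecidableEq (Cell W)} :
    Function.update (memory K φ P X S T) .S (some A) = memory K φ P X (some A) T := by
  funext c
  cases c <;> simp [Function.update, memory]

theorem update_T {inst : DecidableEq (Cell W)} :
    Function.update (memory K φ P X S T) .T (some A) = memory K φ P X S (some A) := by
  funext c
  cases c <;> simp [Function.update, memory]

theorem update_node {inst : DecidableEq (Cell W)} (hx : ψ x = A)
    (h : ∀ y ∈ K, y ≠ x → ψ y = φ y) :
    Function.update (memory K φ P X S T) (.node x) (some A) =
      memory (insert x K) ψ P X S T := by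
  funext c
  cases c with
  | node y =>
    by_cases hy : y = x
    · subst hy
      simp [memory, hx]
    · rw [Function.update_of_ne (by simpa using hy)]
      simp only [memory, Finset.mem_insert, hy, false_or]
      split_ifs with hyK
      · rw [h y hyK hy]
      · rfl
  | _ => simp [Function.update, memory]

theorem update_node_none {inst : DecidableEq (Cell W)} :
    Function.update (memory K φ P X S T) (.node x) none = memory (K.erase x) φ P X S T := by
  funext c
  cases c with
  | node y =>
    by_cases hy : y = x
    · subst hy
      simp [memory]
    · rw [Function.update_of_ne (by simpa using hy)]
      simp [memory, hy]
  | _ => simp [Function.update, memory]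

/-- The set is read at the next stored key; `Gap` says that `φ` has the same value there. -/
theorem eval_getSet (G : ParityGame V d) {s : State W} (htop : ⊤ ∈ s.keys) (hφ : Gap s.keys φ)
    (x : W) : (getSet s x : Operand d (Cell W)).eval G (memory s.keys φ P X S T) =
      some (φ x) := by
  simp only [getSet, Operand.eval, memory, if_pos (ceil_mem htop x)]
  rw [hφ x (ceil s x) (le_ceil s x) fun z hz hxz => ceil_le hz hxz]

variable [Fintype W] {G : ParityGame V d} {M : ℕ}

theorem stored_le (s : State W) (hM : K.card + 4 ≤ M) :
    (Config.mk s (memory K φ P X S T)).stored ≤ M := by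
  classical
  refine le_trans ?_ hM
  have : (Finset.univ.filter fun c => (memory K φ P X S T c).isSome) ⊆
      K.image Cell.node ∪ {.P, .X, .S, .T} := by
    intro c hc
    rw [Finset.mem_filter] at hc
    cases c with
    | node y =>
      have : y ∈ K := by
        by_contra hy
        simp [memory, hy] at hc
      simp [this]
    | _ => simp
  refine (Finset.card_le_card this).trans ((Finset.card_union_le _ _).trans ?_)
  refine Nat.add_le_add Finset.card_image_le ?_
  exact Finset.card_le_four

/-- The set `CPre_𝓔(S)`, as computed by the algorithm. -/
def cpre (G : ParityGame V d) (S : Set V) : Set V :=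
  ({v | G.owner v = .even} ∩ G.Pre S) ∪ ({v | G.owner v = .odd} \ G.Pre (Set.univ \ S))

variable {Q : Config (State W) (Cell W) V → ℕ → ℕ → Prop}

theorem runs_controllablePre {s : State W} (hM : s.keys.card + 4 ≤ M) (htop : ⊤ ∈ s.keys)
    (hφ : Gap s.keys φ)
    (hQ : ∀ X', Q ⟨s, memory s.keys φ (some (cpre G (φ s.r))) X' S T⟩ 2 4) :
    Runs G M controllablePre ⟨s, memory s.keys φ P X S T⟩ Q := by
  have hs : ∀ {P X S T}, (Config.mk s (memory s.keys φ P X S T)).stored ≤ M :=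
    fun {P X S T} => stored_le s hM
  refine runs_cons (runs_pre (eval_getSet G htop hφ s.r) update_P hs hs ?_)
  refine runs_cons (runs_setOp rfl rfl update_P hs hs ?_)
  refine runs_cons (runs_setOp rfl (eval_getSet G htop hφ s.r) update_X hs hs ?_)
  refine runs_cons (runs_pre rfl update_X hs hs ?_)
  refine runs_cons (runs_setOp rfl rfl update_X hs hs ?_)
  refine runs_cons (runs_setOp rfl rfl update_P hs hs ?_)
  exact runs_nil hs (hQ _)

theorem runs_testInner {s : State W} (hM : s.keys.card + 4 ≤ M) (htop : ⊤ ∈ s.keys)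
    (hφ : Gap s.keys φ)
    (hQ : ∀ flag : Bool, (flag = true ↔ ¬ A ⊆ φ s.r') →
      Q ⟨{ s with flag := flag }, memory s.keys φ P (some A) S T⟩ 0 1) :
    Runs G M testInner ⟨s, memory s.keys φ P (some A) S T⟩ Q := by
  refine runs_test (A := A) rfl (eval_getSet G htop hφ s.r') (stored_le s hM) fun ans h => ?_
  refine hQ (!ans) ?_
  change _ ↔ A ⊆ φ s.r' at h
  rw [← h]
  simp

theorem runs_testPrevious {s : State W} (hM : s.keys.card + 4 ≤ M) (htop : ⊤ ∈ s.keys)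
    (hφ : Gap s.keys φ)
    (hQ : ∀ (flag : Bool) T', (flag = true ↔
        (∃ x ∈ s.keys, x < s.r') ∧ B = φ (prev s.keys s.r') ∪ A) →
      Q ⟨{ s with flag := flag }, memory s.keys φ P (some A) (some B) T'⟩ 0 2) :
    Runs G M testPrevious ⟨s, memory s.keys φ P (some A) (some B) T⟩ Q := by
  have hs : ∀ {P X S T}, (Config.mk s (memory s.keys φ P X S T)).stored ≤ M :=
    fun {P X S T} => stored_le s hM
  refine runs_cons (runs_setOp (eval_getSet G htop hφ _) rfl update_T hs hs ?_)
  refine runs_cons (runs_test (A := B) rfl rfl hs fun ans h => ?_)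
  refine runs_nil (stored_le _ hM) (hQ _ _ ?_)
  change _ ↔ B = φ (prev s.keys s.r') ∪ A at h
  rw [← h, Bool.and_eq_true, hasPrevious, decide_eq_true_eq, and_comm]

variable [Fintype V] {f : W → Set V} {l q r : W} {K₀ : Finset W} {L₀ L : List W}

/-- A round costs two set operations, the union and the comparison in `testPrevious`, and is paid
for by the deleted key, which releases two units of `2 * K.card`. -/
theorem runs_removal (hM : 2 * Fintype.card V + 6 ≤ M) (hf : Antitone f)
    (hbot : f ⊥ = Set.univ) (h : RemovalInv f A l K₀ L₀ K L q) (flag : Bool)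
    (hflag : flag = true ↔ (∃ z ∈ K, z < q) ∧ raise f A l q = raise f A l (prev K q)) :
    Runs G M (.while (fun s => s.flag) (.block [removePrevious, testPrevious]))
      ⟨⟨K, L, r, q, flag⟩, memory K (raiseAbove f A l (prev K q)) P (some A)
        (some (raise f A l q)) T⟩
      fun t a b => a = 0 ∧ ∃ K' L' T', t = ⟨⟨K', L', r, q, false⟩,
          memory K' (raiseAbove f A l (prev K' q)) P (some A) (some (raise f A l q)) T'⟩ ∧
        RemovalInv f A l K₀ L₀ K' L' q ∧ InnerInv f A l K₀ L₀ K' L' (prev K' q) ∧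
        L'.length ≤ L.length ∧ b + 2 * K'.card ≤ 2 * K.card := by
  induction hn : K.card using Nat.strong_induction_on generalizing K L flag T with
  | _ n ih =>
  have hM' : ∀ {K L}, RemovalInv f A l K₀ L₀ K L q → K.card + 4 ≤ M := fun h => by
    have := h.card_le hf
    omega
  cases flag with
  | false =>
    refine runs_while_false rfl (stored_le _ (hM' h)) ⟨rfl, K, L, T, rfl, h, ?_, le_rfl, by omega⟩
    exact h.innerInv hf hbot fun h' => Bool.false_ne_true (hflag.2 h')
  | true =>
    obtain ⟨hp, he⟩ := hflag.1 rfl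
    have hpK : prev K q ∈ K := prev_mem hp
    have h' := h.erase hf hbot hp he
    refine runs_while_true rfl ?_
    refine runs_cons (runs_cons (runs_free (update_node_none (x := prev K q))
      (stored_le _ (hM' h)) ?_))
    refine runs_cons (runs_assign (stored_le _ (hM' h')) ?_)
    refine runs_nil (stored_le _ (hM' h')) ?_
    change Runs G M _ (Config.mk (State.mk (K.erase (prev K q)) (L.erase (prev K q)) r q true)
      (memory (K.erase (prev K q)) _ _ _ _ _)) _
    -- Deleting a key lowers `prev`, so the represented function changes, but not at the remaining
    -- keys: the memory is the same.
    rw [memory_congr fun x hx => (h.raiseAbove_erase hx).symm]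
    refine runs_cons (runs_testPrevious (hM' h') h'.top_mem h'.gap fun flag' T' hflag' => ?_)
    refine runs_nil (stored_le _ (hM' h')) ?_
    have hcard := Finset.card_erase_add_one hpK
    dsimp only at hflag'
    rw [raiseAbove_of_le le_rfl, ← raise_of_le ((prev_lt h.bot_lt).le.trans h.le)] at hflag'
    refine (ih _ (by omega) h' flag' hflag' rfl).mono ?_
    rintro t a b ⟨rfl, K', L', T'', rfl, h1, h2, h3, h4⟩
    refine ⟨rfl, K', L', T'', rfl, h1, h2, h3.trans (List.length_erase_le ..), ?_⟩
    omega

theorem activate_eq (K : Finset W) (L : List W) (r q : W) (flag : Bool) :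
    activate ⟨K, L, r, q, flag⟩ = ⟨K, if q ∈ L then L else L ++ [q], r, q, flag⟩ := by
  simp only [activate]
  split_ifs <;> rfl

/-- The constant `9` consists of seven set operations outside the removal loop (one for `S`, two
comparisons with the next key, one copy, two in the first `testPrevious`, one in `testInner`) and
the two units that a new key deposits for its later removal. -/
theorem runs_innerBody (hM : 2 * Fintype.card V + 6 ≤ M) (hf : Antitone f)
    (hbot : f ⊥ = Set.univ) (h : InnerInv f A l K₀ L₀ K L q) (hA : ¬ A ⊆ f q) (flag : Bool) :
    Runs G M innerBody ⟨⟨K, L, r, q, flag⟩, memory K (raiseAbove f A l q) P (some A) S T⟩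
      fun t a b => a = 0 ∧ ∃ K' L' p flag' S' T', p < q ∧
        t = ⟨⟨K', L', r, p, flag'⟩, memory K' (raiseAbove f A l p) P (some A) S' T'⟩ ∧
        (flag' = true ↔ ¬ A ⊆ f p) ∧ InnerInv f A l K₀ L₀ K' L' p ∧
        L'.length ≤ L.length + 1 ∧ b + 2 * K'.card ≤ 2 * K.card + 9 := by
  have hM1 : K.card + 4 ≤ M := by
    have := h.card_le hf
    omega
  set L' : List W := if q ∈ L then L else L ++ [q] with hL'
  have hLL' : L ⊆ L' := by
    rw [hL']
    split_ifs
    · exact List.Subset.refl _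
    · exact List.subset_append_left _ _
  have hqL' : q ∈ L' := by
    rw [hL']
    split_ifs with hq
    · exact hq
    · simp
  have hlen : L'.length ≤ L.length + 1 := by
    rw [hL']
    split_ifs <;> simp
  have h' := h.removalInv hbot hA hLL' hqL'
  have hM2 : (insert q K).card + 4 ≤ M := by
    have := h'.card_le hf
    omega
  have hS : raiseAbove f A l q q ∪ A = raise f A l q := by
    rw [raiseAbove_of_le le_rfl, raise_of_le h.le]
  have hcard : (insert q K).card ≤ K.card + 1 := Finset.card_insert_le _ _
  refine runs_cons (runs_setOp (eval_getSet G h.top_mem h.gap q) rfl update_S (stored_le _ hM1)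
    (stored_le _ hM1) ?_)
  change Runs G M _ (Config.mk _ (memory K _ _ _ (some (raiseAbove f A l q q ∪ A)) _)) _
  rw [hS]
  -- Under the invariant this test always succeeds: `ne_self` and antitonicity make the set at the
  -- next key a proper subset of `S`.
  have htest : Runs G M (.ite (fun s => s.r' = ⊤)
    (.assign fun s => { s with flag := true })
    (.block [
      .test .subset (fun s => getSet s (getNext s s.r')) (fun _ => .cell .S)
        fun ans s => { s with flag := ans },
      .test .eq (fun s => getSet s (getNext s s.r')) (fun _ => .cell .S)
        fun ans s => { s with flag := s.flag && !ans }]))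
      ⟨⟨K, L, r, q, flag⟩, memory K (raiseAbove f A l q) P (some A) (some (raise f A l q)) T⟩
      fun t a b => a = 0 ∧ b ≤ 2 ∧ t = ⟨⟨K, L, r, q, true⟩,
        memory K (raiseAbove f A l q) P (some A) (some (raise f A l q)) T⟩ := by
    refine runs_ite (fun _ => runs_assign (stored_le _ hM1) ⟨rfl, by omega, rfl⟩) fun hq => ?_
    have hq' : q < ⊤ := lt_top_iff_ne_top.2 (by simpa using hq)
    have hnext : ∀ flag, getNext ⟨K, L, r, q, flag⟩ q ∈ K ∧ q < getNext ⟨K, L, r, q, flag⟩ q :=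
      fun flag => getNext_mem h.top_mem hq'
    refine runs_cons (runs_test (eval_getSet G h.top_mem h.gap _) rfl (stored_le _ hM1)
      fun ans hans => ?_)
    refine runs_cons (runs_test (eval_getSet G h.top_mem h.gap _) rfl (stored_le _ hM1)
      fun ans' hans' => ?_)
    refine runs_nil (stored_le _ hM1) ⟨rfl, le_rfl, ?_⟩
    obtain ⟨h1, h2⟩ := hnext flag
    change _ ↔ raiseAbove f A l q (getNext ⟨K, L, r, q, flag⟩ q) ⊆ raise f A l q at hans
    change _ ↔ raiseAbove f A l q (getNext ⟨K, L, r, q, flag⟩ q) = raise f A l q at hans'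
    rw [raiseAbove_of_lt h2] at hans hans'
    have e1 : ans = true := hans.2 (raise_antitone hf h2.le)
    have e2 : ans' = false := Bool.eq_false_iff.2 fun e =>
      h.ne_self hA _ h1 h2 (hans'.1 e).symm
    subst e1 e2
    rfl
  refine runs_cons (htest.mono ?_)
  rintro t a b ⟨rfl, hb, rfl⟩
  refine runs_cons (runs_ite (fun _ => ?_) fun hfalse => absurd hfalse (by simp))
  refine runs_cons (runs_cons (runs_setOp (A := raise f A l q) (B := raise f A l q) rfl rfl
    (update_node (ψ := raiseAbove f A l (prev (insert q K) q)) ?_ ?_)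
    (stored_le _ hM1) (stored_le _ hM2) ?_))
  · rw [raiseAbove_of_lt (prev_lt h'.bot_lt)]
    exact (Set.union_self _).symm
  · intro y hy hyq
    rw [prev_insert_self]
    exact raiseAbove_prev_of_ne hy hyq h'.bot_lt
  refine runs_cons (runs_assign (stored_le _ hM2) ?_)
  refine runs_nil (stored_le _ hM2) ?_
  refine runs_cons (runs_assign (stored_le _ hM2) ?_)
  refine runs_nil (stored_le _ hM2) ?_
  rw [activate_eq]
  refine runs_cons (runs_testPrevious hM2 h'.top_mem h'.gap fun flag' T' hflag' => ?_)
  dsimp only at hflag'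
  rw [raiseAbove_of_le le_rfl, ← raise_of_le ((prev_lt h'.bot_lt).le.trans h'.le)] at hflag'
  refine runs_cons ((runs_removal hM hf hbot h' flag' hflag').mono ?_)
  rintro t a b' ⟨rfl, K', L'', T'', rfl, h1, h2, h3, h4⟩
  have hM3 : K'.card + 4 ≤ M := by
    have := h1.card_le hf
    omega
  refine runs_cons (runs_assign (stored_le _ hM3) ?_)
  refine runs_cons (runs_testInner hM3 h2.top_mem h2.gap fun flag'' hflag'' => ?_)
  refine runs_nil (stored_le _ hM3) ?_
  refine ⟨rfl, K', L'', prev K' q, flag'', _, _, prev_lt h1.bot_lt, rfl, ?_, h2, h3.trans hlen,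
    by omega⟩
  rw [hflag'']
  change ¬ A ⊆ raiseAbove f A l (prev K' q) (prev K' q) ↔ _
  rw [raiseAbove_of_le le_rfl]

/-- Termination holds because `q` decreases. Each round adds a vertex somewhere, so the drop in
`slack` pays for the possible new active element and for the nine units of work. -/
theorem runs_innerLoop (hM : 2 * Fintype.card V + 6 ≤ M) (hf : Antitone f)
    (hbot : f ⊥ = Set.univ) (h : InnerInv f A l K₀ L₀ K L q) (flag : Bool)
    (hflag : flag = true ↔ ¬ A ⊆ f q) :
    Runs G M (.while (fun s => s.flag) innerBody)
      ⟨⟨K, L, r, q, flag⟩, memory K (raiseAbove f A l q) P (some A) S T⟩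
      fun t a b => a = 0 ∧ ∃ K' L' p S' T',
        t = ⟨⟨K', L', r, p, false⟩, memory K' (raise f A l) P (some A) S' T'⟩ ∧
        Tree K' (raise f A l) ∧ Quiet K' L' (raise f A l) K₀ L₀ f ∧
        L'.length + slack (raise f A l) ≤ L.length + slack (raiseAbove f A l q) ∧
        b + 2 * K'.card + 9 * slack (raise f A l) ≤
          2 * K.card + 9 * slack (raiseAbove f A l q) := by
  induction q using WellFoundedLT.induction generalizing K L flag S T with
  | _ q ih =>
  cases flag with
  | false =>
    have hA : A ⊆ f q := by
      by_contra hA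
      exact Bool.false_ne_true (hflag.2 hA)
    have hM1 : K.card + 4 ≤ M := by
      have := h.card_le hf
      omega
    have e := raiseAbove_eq_raise hf h.le hA
    rw [e]
    exact runs_while_false rfl (stored_le _ hM1) ⟨rfl, K, L, q, S, T, rfl, h.tree hf hbot hA,
      e ▸ h.quiet, le_rfl, by omega⟩
  | true =>
    refine runs_while_true rfl ((runs_innerBody hM hf hbot h (hflag.1 rfl) true).mono ?_)
    rintro t a b ⟨rfl, K', L', p, flag', S', T', hpq, rfl, hflag', h', hL, hb⟩
    refine (ih p hpq h' flag' hflag').mono ?_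
    rintro t a b' ⟨rfl, K'', L'', p', S'', T'', rfl, h1, h2, h3, h4⟩
    have := slack_raiseAbove_lt hpq h.le (hflag.1 rfl)
    exact ⟨rfl, K'', L'', p', S'', T'', rfl, h1, h2, by omega, by omega⟩

/-- The set of vertices of priority `c` in `B`. -/
def ofPrio (G : ParityGame V d) (B : Set V) (c : Fin d) : Set V := B ∩ {v | G.priority v = c}

theorem runs_forBody (hM : 2 * Fintype.card V + 6 ≤ M) (lift : W → Fin d → W) (c : Fin d)
    (h : Tree K φ) (r' : W) (flag : Bool) :
    Runs G M (forBody lift c) ⟨⟨K, L, r, r', flag⟩, memory K φ (some B) X S T⟩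
      fun t a b => a = 0 ∧ ∃ K' L' p X' S' T',
        t = ⟨⟨K', L', r, p, false⟩,
          memory K' (raise φ (ofPrio G B c) (lift r c)) (some B) X' S' T'⟩ ∧
        Tree K' (raise φ (ofPrio G B c) (lift r c)) ∧
        Quiet K' L' (raise φ (ofPrio G B c) (lift r c)) K L φ ∧
        L'.length + slack (raise φ (ofPrio G B c) (lift r c)) ≤ L.length + slack φ ∧
        b + 2 * K'.card + 9 * slack (raise φ (ofPrio G B c) (lift r c)) ≤
          2 + 2 * K.card + 9 * slack φ := by
  have hM1 : K.card + 4 ≤ M := by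
    have := card_le_of_antitone h.anti h.ne
    omega
  refine runs_cons (runs_assign (stored_le _ hM1) ?_)
  refine runs_cons (runs_setOp (A := B) rfl rfl update_X (stored_le _ hM1) (stored_le _ hM1) ?_)
  refine runs_cons (runs_testInner hM1 h.top_mem h.gap fun flag' hflag' => ?_)
  have hi := h.innerInv (ofPrio G B c) (lift r c) L
  have hloop := runs_innerLoop (G := G) (M := M) (r := r) (P := some B) (S := S) (T := T)
    hM h.anti h.bot hi flag' hflag'
  rw [raiseAbove_self] at hloop
  refine runs_cons (hloop.mono ?_)
  rintro t a b ⟨rfl, K', L', p, S', T', rfl, h1, h2, h3, h4⟩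
  have hM2 : K'.card + 4 ≤ M := by
    have := card_le_of_antitone h1.anti h1.ne
    omega
  exact runs_nil (stored_le _ hM2) ⟨rfl, K', L', p, _, S', T', rfl, h1, h2, h3, by omega⟩

/-- The contents are bounded from both sides: all vertices that `lift` demands are added, which
later gives closedness, and only such vertices are added, which gives soundness. -/
theorem runs_for (hM : 2 * Fintype.card V + 6 ≤ M) (lift : W → Fin d → W) (cs : List (Fin d))
    (h : Tree K φ) (r' : W) (flag : Bool) :
    Runs G M (.block (cs.map (forBody lift))) ⟨⟨K, L, r, r', flag⟩, memory K φ (some B) X S T⟩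
      fun t a b => a = 0 ∧ ∃ K' L' p flag' X' S' T' φ',
        t = ⟨⟨K', L', r, p, flag'⟩, memory K' φ' (some B) X' S' T'⟩ ∧
        Tree K' φ' ∧ Quiet K' L' φ' K L φ ∧ (∀ x, φ x ⊆ φ' x) ∧
        (∀ c ∈ cs, ofPrio G B c ⊆ φ' (lift r c)) ∧
        (∀ x, ∀ v ∈ φ' x, v ∈ φ x ∨ v ∈ B ∧ x ≤ lift r (G.priority v)) ∧
        L'.length + slack φ' ≤ L.length + slack φ ∧
        b + 2 * K'.card + 9 * slack φ' ≤ 2 * cs.length + 2 * K.card + 9 * slack φ := by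
  induction cs generalizing K L r' flag X S T φ with
  | nil =>
    have hM1 : K.card + 4 ≤ M := by
      have := card_le_of_antitone h.anti h.ne
      omega
    exact runs_nil (stored_le _ hM1) ⟨rfl, K, L, r', flag, X, S, T, φ, rfl, h,
      fun x hx hL => ⟨hx, hL, rfl⟩, fun _ => subset_rfl, by simp, fun x v hv => Or.inl hv,
      le_rfl, by simp⟩
  | cons c cs ih =>
    refine runs_cons ((runs_forBody hM lift c h r' flag).mono ?_)
    rintro t a b ⟨rfl, K', L', p, X', S', T', rfl, h1, h2, h3, h4⟩
    refine (ih h1 p false).mono ?_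
    rintro t a b' ⟨rfl, K'', L'', p', flag', X'', S'', T'', φ', rfl, k1, k2, k3, k4, k5, k6, k7⟩
    refine ⟨rfl, K'', L'', p', flag', X'', S'', T'', φ', rfl, k1, k2.trans h2,
      fun x => le_raise.trans (k3 x), ?_, ?_, by omega, ?_⟩
    · intro c' hc'
      rcases List.mem_cons.1 hc' with rfl | hc'
      · refine subset_trans ?_ (k3 _)
        rw [raise_of_le le_rfl]
        exact Set.subset_union_right
      · exact k4 c' hc'
    · intro x v hv
      rcases k5 x v hv with hv | hv
      · rcases hv with hv | hv
        · exact Or.inl hv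
        · split_ifs at hv with hx
          · obtain ⟨hvB, rfl⟩ := hv
            exact Or.inr ⟨hvB, hx⟩
          · exact hv.elim
      · exact Or.inr hv
    · rw [List.length_cons]
      omega

/-- The measure `g` is consistent with `lift` on all moves. -/
def IsMeasure (G : ParityGame V d) (lift : W → Fin d → W) (g : V → W) : Prop :=
  ∀ r v, v ∈ cpre G {w | r ≤ g w} → lift r (G.priority v) ≤ g v

theorem cpre_mono (G : ParityGame V d) : Monotone (cpre G) := fun A B h => by
  refine Set.union_subset_union (Set.inter_subset_inter_right _ ?_)
    (Set.sdiff_subset_sdiff_right ?_)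
  · rintro v ⟨w, he, hw⟩
    exact ⟨w, he, h hw⟩
  · rintro v ⟨w, he, hw⟩
    exact ⟨w, he, hw.1, fun hA => hw.2 (h hA)⟩

/-- The invariant of the outer while-loop. -/
structure OuterInv (G : ParityGame V d) (lift : W → Fin d → W) (K : Finset W) (L : List W)
    (φ : W → Set V) : Prop where
  tree : Tree K φ
  closed : ∀ x ∈ K, x ∉ L → ∀ c, ofPrio G (cpre G (φ x)) c ⊆ φ (lift x c)
  sound : ∀ g, IsMeasure G lift g → ∀ x, φ x ⊆ {v | x ≤ g v}

theorem runs_outerBody (hM : 2 * Fintype.card V + 6 ≤ M) (lift : W → Fin d → W)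
    (h : OuterInv G lift K (q :: L) φ) (r r' : W) (flag : Bool) :
    Runs G M (outerBody lift) ⟨⟨K, q :: L, r, r', flag⟩, memory K φ P X S T⟩
      fun t a b => a = 2 ∧ ∃ K' L' r' p flag' P' X' S' T' φ',
        t = ⟨⟨K', L', r', p, flag'⟩, memory K' φ' P' X' S' T'⟩ ∧ OuterInv G lift K' L' φ' ∧
        L'.length + slack φ' ≤ L.length + slack φ ∧
        b + 2 * K'.card + 9 * slack φ' ≤ 4 + 2 * d + 2 * K.card + 9 * slack φ := by
  have hM1 : K.card + 4 ≤ M := by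
    have := card_le_of_antitone h.tree.anti h.tree.ne
    omega
  refine runs_cons (runs_assign (stored_le _ hM1) ?_)
  refine runs_cons (runs_controllablePre hM1 h.tree.top_mem h.tree.gap fun X' => ?_)
  refine runs_cons ((runs_for hM lift (List.finRange d) h.tree r' flag).mono ?_)
  rintro t a b ⟨rfl, K', L', p, flag', X'', S', T', φ', rfl, k1, k2, k3, k4, k5, k6, k7⟩
  rw [List.length_finRange] at k7
  have hM2 : K'.card + 4 ≤ M := by
    have := card_le_of_antitone k1.anti k1.ne
    omega
  refine runs_nil (stored_le _ hM2) ⟨rfl, K', L', _, p, flag', _, X'', S', T', φ', rfl, ?_, k6,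
    by omega⟩
  -- A key that ends up inactive has kept its set. Either it is the popped `q`, whose demands have
  -- just been met, or it was inactive before, and its demands remain met because sets only grow.
  -- Soundness passes through `cpre` by monotonicity and then uses the measure property.
  refine ⟨k1, fun x hx hxL c => ?_, fun g hg x v hv => ?_⟩
  · obtain ⟨h1, h2, h3⟩ := k2 x hx hxL
    rw [h3]
    by_cases hxq : x = q
    · subst hxq
      exact k4 c (List.mem_finRange c)
    · exact (h.closed x h1 (by
        rw [List.mem_cons, not_or]
        exact ⟨hxq, h2⟩) c).trans (k3 _)
  · rcases k5 x v hv with hv | ⟨hv, hx⟩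
    · exact h.sound g hg x hv
    · exact hx.trans (hg _ v (cpre_mono G (h.sound g hg _) hv))

/-- Each round pops one element, and every activation is matched by a drop in `slack`, so `L.length
+ slack φ` decreases strictly. It starts at no more than `n * |W| + 1`. -/
theorem runs_outerLoop (hM : 2 * Fintype.card V + 6 ≤ M) (lift : W → Fin d → W)
    (h : OuterInv G lift K L φ) (r r' : W) (flag : Bool) :
    Runs G M (.while (fun s => !s.active.isEmpty) (outerBody lift))
      ⟨⟨K, L, r, r', flag⟩, memory K φ P X S T⟩
      fun t a b => ∃ (s : State W) (K' : Finset W) (P' X' S' T' : Option (Set V)) (φ' : W → Set V),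
        t = ⟨s, memory K' φ' P' X' S' T'⟩ ∧ OuterInv G lift K' [] φ' ∧
        a ≤ 2 * (L.length + slack φ) ∧
        b ≤ (4 + 2 * d) * (L.length + slack φ) + 2 * K.card + 9 * slack φ := by
  induction hn : L.length + slack φ using Nat.strong_induction_on
    generalizing K L φ P X S T r r' flag with
  | _ n ih =>
  cases L with
  | nil =>
    have hM1 : K.card + 4 ≤ M := by
      have := card_le_of_antitone h.tree.anti h.tree.ne
      omega
    exact runs_while_false rfl (stored_le _ hM1) ⟨_, K, P, X, S, T, φ, rfl, h, by omega, by omega⟩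
  | cons q L =>
    refine runs_while_true rfl ((runs_outerBody hM lift h r r' flag).mono ?_)
    rintro t a b ⟨rfl, K', L', r₁, p, flag', P', X', S', T', φ', rfl, h1, h2, h3⟩
    rw [List.length_cons] at hn
    refine (ih _ (by omega) h1 r₁ p flag' rfl).mono ?_
    rintro t a b' ⟨s, K'', P'', X'', S'', T'', φ'', rfl, k1, k2, k3⟩
    refine ⟨s, K'', P'', X'', S'', T'', φ'', rfl, k1, by omega, ?_⟩
    have hm : (4 + 2 * d) * (L'.length + slack φ') + (4 + 2 * d) ≤ (4 + 2 * d) * n := by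
      rw [← Nat.mul_succ]
      exact Nat.mul_le_mul_left _ (by omega)
    omega

/-- The black box algorithm terminates in a fixed point of `lift` that is below every measure. -/
theorem runs_algorithm [Nonempty V] (hne : (⊥ : W) ≠ ⊤) (lift : W → Fin d → W) :
    Runs G (2 * Fintype.card V + 6) (algorithm lift) (start W V)
      fun t a b => ∃ (s : State W) (K : Finset W) (P X S T : Option (Set V)) (φ : W → Set V),
        t = ⟨s, memory K φ P X S T⟩ ∧ OuterInv G lift K [] φ ∧
        a ≤ 2 * (Fintype.card V * Fintype.card W + 1) ∧
        b ≤ (4 + 2 * d) * (Fintype.card V * Fintype.card W + 1) + 6 +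
          9 * (Fintype.card V * Fintype.card W) := by
  classical
  let φ : W → Set V := fun x => if x = ⊥ then Set.univ else ∅
  have hφb : φ ⊥ = Set.univ := if_pos rfl
  have hφt : ∀ {x}, x ≠ ⊥ → φ x = ∅ := fun h => if_neg h
  have hc0 : (∅ : Finset W).card + 4 ≤ 2 * Fintype.card V + 6 := by simp
  have hc1 : (insert ⊥ (∅ : Finset W)).card + 4 ≤ 2 * Fintype.card V + 6 := by simp
  have hcard : ({⊥, ⊤} : Finset W).card ≤ 2 := Finset.card_le_two
  have hc2 : ({⊥, ⊤} : Finset W).card + 4 ≤ 2 * Fintype.card V + 6 := by omega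
  have hins : insert ⊤ (insert ⊥ (∅ : Finset W)) = {⊥, ⊤} := by
    ext x
    simp [or_comm]
  have hstart : start W V = ⟨⟨∅, [], ⊥, ⊥, false⟩, memory ∅ φ none none none none⟩ := by
    have : (memory ∅ φ none none none none : Cell W → Option (Set V)) = fun _ => none := by
      funext c
      cases c <;> simp [memory]
    rw [this]
    rfl
  have hinv : OuterInv G lift {⊥, ⊤} [⊥] φ := by
    refine ⟨⟨by simp, ?_, ?_, hφb, ?_⟩, ?_, ?_⟩
    · intro x y hxy hz
      by_cases hx : x = ⊥
      · subst hx
        rw [le_bot_iff.1 (hz ⊥ (by simp) le_rfl)]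
      · rw [hφt hx, hφt fun hy => hx (le_bot_iff.1 (hy ▸ hxy))]
    · intro x y hxy
      by_cases hx : x = ⊥
      · rw [hx, hφb]
        exact Set.subset_univ _
      · rw [hφt fun hy => hx (le_bot_iff.1 (hy ▸ hxy))]
        exact Set.empty_subset _
    · intro x hx y hy hxy he
      have hy' : y ≠ ⊥ := (bot_le.trans_lt hxy).ne'
      rw [hφt hy'] at he
      by_cases hx' : x = ⊥
      · rw [hx', hφb] at he
        exact Set.univ_nonempty.ne_empty he
      · have hxt : x = ⊤ := by simpa [hx'] using hx
        exact absurd hxy (hxt ▸ not_top_lt)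
    · intro x hx hxL c
      have hxt : x = ⊤ := by
        have : x ≠ ⊥ := by simpa using hxL
        simpa [this] using hx
      rw [hxt, hφt hne.symm]
      -- The inactive key `⊤` holds the empty set, whose controllable predecessor is empty because
      -- every vertex has a successor.
      rintro v ⟨⟨_, w, _, hw⟩ | ⟨_, hv⟩, _⟩
      · exact hw.elim
      · obtain ⟨w, hw⟩ := G.exists_edge v
        exact absurd ⟨w, hw, trivial, fun h => h⟩ hv
    · intro g _ x v hv
      by_cases hx : x = ⊥
      · rw [hx]
        exact bot_le
      · rw [hφt hx] at hv
        exact hv.elim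
  have hsl := slack_le φ
  rw [hstart]
  refine runs_cons (runs_cons (runs_setOp (A := Set.univ) (B := Set.univ) rfl rfl
    (update_node (ψ := φ) (hφb.trans (Set.union_self _).symm) fun _ h => by simp at h)
    (stored_le _ hc0) (stored_le _ hc1) ?_))
  refine runs_cons (runs_setOp (A := Set.univ) (B := Set.univ) rfl rfl
    (update_node (ψ := φ) ((hφt hne.symm).trans (Set.sdiff_self).symm) fun _ _ _ => rfl)
    (stored_le _ hc1) (stored_le _ (hins ▸ hc2)) ?_)
  rw [hins]
  refine runs_cons (runs_assign (stored_le _ hc2) ?_)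
  refine runs_nil (stored_le _ hc2) ?_
  refine runs_cons ((runs_outerLoop le_rfl lift hinv ⊥ ⊥ false).mono ?_)
  rintro t a b ⟨s, K, P, X, S, T, ψ, rfl, h1, h2, h3⟩
  have hM1 : K.card + 4 ≤ 2 * Fintype.card V + 6 := by
    have := card_le_of_antitone h1.tree.anti h1.tree.ne
    omega
  refine runs_nil (stored_le _ hM1) ⟨s, K, P, X, S, T, ψ, rfl, h1, ?_, ?_⟩
  · simp only [List.length_singleton] at h2
    omega
  · simp only [List.length_singleton] at h3
    have hm : (4 + 2 * d) * (1 + slack φ) ≤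
        (4 + 2 * d) * (Fintype.card V * Fintype.card W + 1) :=
      Nat.mul_le_mul_left _ (by omega)
    omega

end BlackBox

/-! ### From the final sets to a measure. -/

namespace BlackBox

set_option linter.unusedSectionVars false

variable {W : Type} [LinearOrder W] [BoundedOrder W] [Fintype W] {d : ℕ} {V : Type*}
  {G : ParityGame V d} {lift : W → Fin d → W} {K : Finset W} {φ : W → Set V}

theorem cpre_even {S : Set V} {v w : V} (ho : G.owner v = .even) (he : G.edge v w) (hw : w ∈ S) :
    v ∈ cpre G S := Or.inl ⟨ho, w, he, hw⟩

theorem cpre_odd {S : Set V} {v : V} (ho : G.owner v = .odd) (h : ∀ w, G.edge v w → w ∈ S) :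
    v ∈ cpre G S := Or.inr ⟨ho, fun ⟨w, he, hw⟩ => hw.2 (h w he)⟩

/-- Closedness at the keys spreads to all of `W`: `φ` agrees at `x` and at the next key, and `lift`
of the larger key is larger, which gives a smaller set. -/
theorem OuterInv.closed_all (h : OuterInv G lift K [] φ) (hl : ∀ c, Monotone fun r => lift r c)
    (x : W) (c : Fin d) : ofPrio G (cpre G (φ x)) c ⊆ φ (lift x c) := by
  let s : State W := ⟨K, [], ⊥, ⊥, false⟩
  rw [h.tree.gap x (ceil s x) (le_ceil s x) fun z hz hxz => ceil_le (s := s) hz hxz]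
  exact (h.closed _ (ceil_mem (s := s) h.tree.top_mem x) List.not_mem_nil c).trans
    (h.tree.anti (hl c (le_ceil s x)))

/-- The final sets are the level sets of a measure. -/
theorem OuterInv.exists_isMeasure (h : OuterInv G lift K [] φ)
    (hl : ∀ c, Monotone fun r => lift r c) :
    ∃ g, IsMeasure G lift g ∧ ∀ x, φ x = {v | x ≤ g v} := by
  classical
  -- The largest `x` whose set contains `v`; it exists because `φ ⊥` is everything.
  let g : V → W := fun v => (Finset.univ.filter (v ∈ φ ·)).sup id
  have hg : ∀ x, φ x = {v | x ≤ g v} := fun x => by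
    ext v
    refine ⟨fun hv => Finset.le_sup (f := id) (by simpa using hv), fun hv => ?_⟩
    obtain ⟨y, hy, he⟩ := Finset.exists_mem_eq_sup (Finset.univ.filter (v ∈ φ ·))
      ⟨⊥, by simp [h.tree.bot]⟩ id
    have hxy : x ≤ y := le_of_le_of_eq hv he
    exact h.tree.anti hxy (by simpa using hy)
  refine ⟨g, fun r v hv => ?_, hg⟩
  rw [← hg r] at hv
  have := h.closed_all hl r (G.priority v) ⟨hv, rfl⟩
  rwa [hg] at this

end BlackBox

/-! ### Measures and winning regions. -/

namespace OPM

open BlackBox ParityGame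

variable {k d : ℕ} {V : Type*} {G : ParityGame V d}

theorem lift_top (c : Fin d) : lift (⊤ : Rank k d) c = ⊤ := by
  obtain ⟨s, hs, h⟩ := exists_lift_eq (⊤ : Rank k d) c
  rw [h, top_le_iff.1 hs, basicUpdate_top]

/-- Measures are `⊤` on the vertices from which player `𝓔` wins. -/
theorem eq_top_of_forces_even [Finite V] {g : V → Rank k d} (hg : IsMeasure G lift g) {U : Set V}
    {σ : V → V} (hU : G.Forces .even Set.univ ∅ U (G.Wins .even) σ) {v : V} (hv : v ∈ U) :
    g v = ⊤ := by
  classical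
  -- Player `𝓔` follows `σ` inside `U`, and player `𝓞` moves to a successor of minimal measure: then
  -- `u` is a controllable predecessor of the level set of `g w` in either case.
  have hnext : ∀ u, ∃ w, G.edge u w ∧ lift (g w) (G.priority u) ≤ g u ∧
      (G.owner u = .even → u ∈ U → w = σ u) := by
    intro u
    by_cases ho : G.owner u = .even
    · obtain ⟨w, he, hw⟩ : ∃ w, G.edge u w ∧ (u ∈ U → w = σ u) := by
        by_cases hu : u ∈ U
        · exact ⟨σ u, (hU.own u hu (by simp) ho).1, fun _ => rfl⟩
        · obtain ⟨w, hw⟩ := G.exists_edge u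
          exact ⟨w, hw, fun h => absurd h hu⟩
      exact ⟨w, he, hg _ u (cpre_even ho he (le_refl (g w))), fun _ => hw⟩
    · obtain ⟨w, he, hw⟩ := Set.exists_min_image {w | G.edge u w} g (Set.toFinite _)
        (G.exists_edge u)
      exact ⟨w, he, hg _ u (cpre_odd (Player.ne_iff.1 ho) hw), fun h => absurd h ho⟩
  choose nx hnx using hnext
  let x : ℕ → V := fun i => nx^[i] v
  have hx : ∀ i, x (i + 1) = nx (x i) := fun i => Function.iterate_succ_apply' nx i v
  obtain ⟨-, p, hp, hev⟩ := hU.wins_of_follows (x := x) hv fun i => by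
    rw [hx]
    exact ⟨(hnx _).1, (hnx _).2.2⟩
  have hle : ∀ i, lift (g (x (i + 1))) (G.priority (x i)) ≤ g (x i) := fun i => by
    rw [hx]
    exact (hnx _).2.1
  by_contra hne
  -- Since `lift` maps `⊤` to `⊤`, a rank below `⊤` is never followed by `⊤`.
  have hfin : ∀ i, g (x i) ≠ ⊤ := by
    intro i
    induction i with
    | zero => exact hne
    | succ i ih =>
      intro h
      have := hle i
      rw [h, lift_top] at this
      exact ih (top_le_iff.1 this)
  choose b hb using fun i => WithTop.ne_top_iff_exists.1 (hfin i)
  refine not_even_isGreatest_of_lift_le b (fun i => G.priority (x i)) p (fun i => ?_) hev hp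
  rw [hb, hb]
  exact hle i

/-- The reverse of a path in `U` on which player `𝓞` follows `π`. -/
def IsReversePath (G : ParityGame V d) (U : Set V) (π : V → V) (x : ℕ → V) (m : ℕ) : Prop :=
  (∀ t ≤ m, x t ∈ U) ∧ ∀ t < m, G.edge (x (t + 1)) (x t) ∧
    (G.owner (x (t + 1)) = .odd → x t = π (x (t + 1)))

/-- A repeated vertex closes a cycle that respects `π`. Traversing it forever is a play with limit
priority `p`; were `p` even, `𝓔` would win against the winning strategy of `𝓞`. -/
theorem IsReversePath.not_evenBetween {U : Set V} {π : V → V} {x : ℕ → V} {m s e : ℕ}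
    (hx : IsReversePath G U π x m) (hU : G.Forces .odd Set.univ ∅ U (G.Wins .odd) π)
    (hse : s < e) (hem : e ≤ m) (heq : x s = x e) :
    ¬ EvenBetween (fun t => G.priority (x t)) s e := by
  rintro ⟨p, hp, ⟨u, hsu, hue, hu⟩, hle⟩
  set L := e - s
  have hL : 0 < L := by omega
  -- The path is stored in reverse, so the play runs from `e` down to `s + 1` and jumps back to `e`,
  -- which is the same vertex as `s`.
  let y : ℕ → V := fun i => x (e - i % L)
  have hmod : ∀ i, i % L < L := fun i => Nat.mod_lt i hL
  have hy : ∀ i, y (i + 1) = x (e - i % L - 1) := by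
    intro i
    have hi := hmod i
    have h1 : (i + 1) % L = (i % L + 1) % L := (Nat.mod_add_mod i L 1).symm
    by_cases hiL : i % L + 1 < L
    · change x (e - (i + 1) % L) = _
      rw [h1, Nat.mod_eq_of_lt hiL]
      congr 1
    · have h2 : i % L + 1 = L := by omega
      change x (e - (i + 1) % L) = _
      rw [h1, h2, Nat.mod_self, Nat.sub_zero, ← heq]
      congr 1
      omega
  have hstep : ∀ i, G.edge (y i) (y (i + 1)) ∧ (G.owner (y i) = .odd → y (i + 1) = π (y i)) := by
    intro i
    have hi := hmod i
    have := hx.2 (e - i % L - 1) (by omega)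
    rw [hy, show y i = x (e - i % L - 1 + 1) by
      change x (e - i % L) = _
      congr 1
      omega]
    exact this
  have hw := (hU.wins_of_follows (x := y) (hx.1 _ (by omega)) fun i =>
    ⟨(hstep i).1, fun ho _ => (hstep i).2 ho⟩).2
  refine G.not_wins_even_and_odd ⟨p, ⟨?_, ?_⟩, hp⟩ hw
  -- The play `y` omits index `s`; an occurrence of `p` there is replaced by the one at `e`.
  · obtain ⟨u, hsu, hue, hu⟩ : ∃ u, s < u ∧ u ≤ e ∧ G.priority (x u) = p := by
      rcases hsu.eq_or_lt with rfl | hsu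
      · exact ⟨e, hse, le_rfl, heq ▸ hu⟩
      · exact ⟨u, hsu, hue, hu⟩
    refine Filter.frequently_atTop.2 fun N => ⟨(e - u) + N * L, ?_, ?_⟩
    · have := Nat.le_mul_of_pos_right N hL
      omega
    · change G.priority (x (e - (e - u + N * L) % L)) = p
      rw [Nat.add_mul_mod_self_right, Nat.mod_eq_of_lt (by omega), Nat.sub_sub_self hue, hu]
  · rintro c hc
    obtain ⟨i, hi⟩ := hc.exists
    have := hmod i
    exact hi ▸ hle (e - i % L) (by omega) (by omega)

/-- Pigeonhole: among `2 ^ k` times of a chain, more than there are vertices, two share a vertex. -/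
theorem IsReversePath.readRank_ne_top [Fintype V] {U : Set V} {π : V → V} {x : ℕ → V} {m : ℕ}
    (hx : IsReversePath G U π x m) (hU : G.Forces .odd Set.univ ∅ U (G.Wins .odd) π)
    (hk : Fintype.card V < 2 ^ k) :
    readRank k (fun t => G.priority (x t)) (m + 1) ≠ ⊤ := by
  intro h
  obtain ⟨s, e, he, F, hF, hFb, -, -, hch⟩ := exists_evenChain_of_readRank_eq_top h
  obtain ⟨u, hu, v, hv, hne, heq⟩ := Finset.exists_ne_map_eq_of_card_lt_of_maps_to
    (s := F) (t := Finset.univ) (by rwa [hF, Finset.card_univ]) (f := x) (fun _ _ => by simp)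
  have hu' := hFb u hu
  have hv' := hFb v hv
  rcases lt_or_gt_of_ne hne with huv | huv
  · exact hx.not_evenBetween hU huv (by omega) heq (hch u hu v hv huv)
  · exact hx.not_evenBetween hU huv (by omega) heq.symm (hch v hv u hu huv)

/-- There is a measure that is below `⊤` on the vertices from which player `𝓞` wins. -/
theorem exists_isMeasure_lt_top [Fintype V] {U : Set V} {π : V → V}
    (hU : G.Forces .odd Set.univ ∅ U (G.Wins .odd) π) (hk : Fintype.card V < 2 ^ k) :
    ∃ g : V → Rank k d, IsMeasure G lift g ∧ ∀ v ∈ U, g v < ⊤ := by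
  classical
  let Reads : V → Rank k d → Prop := fun v r => ∃ x m, x m = v ∧ IsReversePath G U π x m ∧
    r = readRank k (fun t => G.priority (x t)) (m + 1)
  -- The worst rank that can be read on a reversed path ending in `v`. The maximum is attained, as
  -- there are finitely many ranks and the one-vertex path is available.
  let g : V → Rank k d := fun v =>
    if v ∈ U then (Finset.univ.filter (Reads v)).sup id else ⊤
  have hle : ∀ v ∈ U, ∀ r, Reads v r → r ≤ g v := fun v hv r hr => by
    simp only [g, if_pos hv]
    exact Finset.le_sup (f := id) (by simpa using hr)
  have hreads : ∀ v ∈ U, Reads v (g v) := fun v hv => by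
    obtain ⟨r, hr, he⟩ := Finset.exists_mem_eq_sup (Finset.univ.filter (Reads v))
      ⟨readRank k (fun _ => G.priority v) 1, by
        simp only [Finset.mem_filter, Finset.mem_univ, true_and]
        exact ⟨fun _ => v, 0, rfl, ⟨fun _ _ => hv, fun t ht => absurd ht (Nat.not_lt_zero t)⟩,
          rfl⟩⟩ id
    simp only [g, if_pos hv]
    rw [he]
    simpa using hr
  refine ⟨g, fun r v hv => ?_, fun v hv => ?_⟩
  · by_cases hvU : v ∈ U
    · obtain ⟨w, hwU, he, ho, hr⟩ : ∃ w ∈ U, G.edge v w ∧ (G.owner v = .odd → w = π v) ∧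
          r ≤ g w := by
        rcases hv with ⟨ho, w, he, hw⟩ | ⟨ho, hw⟩
        · have ho' : G.owner v ≠ .odd := fun h => by
            cases h.symm.trans ho
          exact ⟨w, hU.opp v hvU (by simp) ho' w trivial he, he, fun h => absurd h ho', hw⟩
        · obtain ⟨he, hπ⟩ := hU.own v hvU (by simp) ho
          exact ⟨π v, hπ, he, fun _ => rfl, by_contra fun h => hw ⟨_, he, trivial, h⟩⟩
      obtain ⟨x, m, hxm, hx, hgw⟩ := hreads w hwU
      refine (lift_mono _ hr).trans ((lift_le_basicUpdate _ _).trans (hle v hvU _ ?_))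
      -- Appending `v` to the reversed path that realizes `g w` reads one more priority, so
      -- `basicUpdate (g w) (priority v)` is among the ranks read at `v`.
      refine ⟨fun t => if t ≤ m then x t else v, m + 1, by simp, ⟨fun t ht => ?_, fun t ht => ?_⟩,
        ?_⟩
      · dsimp only
        split_ifs with h
        · exact hx.1 t h
        · exact hvU
      · rcases (Nat.lt_succ_iff.1 ht).eq_or_lt with rfl | hlt
        · simpa [hxm] using ⟨he, ho⟩
        · have h1 : t + 1 ≤ m := hlt
          simpa [hlt.le, h1] using hx.2 t hlt
      · rw [readRank, hgw]
        congr 1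
        · refine readRank_congr fun i hi => ?_
          beta_reduce
          rw [if_pos (Nat.lt_succ_iff.1 hi)]
        · simp
    · simp [g, hvU]
  · obtain ⟨x, m, -, hx, h⟩ := hreads v hv
    rw [h]
    exact lt_top_iff_ne_top.2 (hx.readRank_ne_top hU hk)

theorem bot_ne_top : (⊥ : Rank k d) ≠ ⊤ := WithTop.coe_ne_top

/-- The result of the algorithm is the winning set of player `𝓔`. -/
theorem eq_winSet_of_outerInv [Fintype V] {K : Finset (Rank k d)} {φ : Rank k d → Set V}
    (h : OuterInv G lift K [] φ) (hk : Fintype.card V < 2 ^ k) :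
    φ ⊤ = G.winSet .even ∧ (φ ⊤)ᶜ = G.winSet .odd := by
  obtain ⟨U, hU, hcov⟩ := exists_forces_cover G Set.univ fun v _ => by
    obtain ⟨w, hw⟩ := G.exists_edge v
    exact ⟨w, trivial, hw⟩
  obtain ⟨σ, hσ⟩ := hU .even
  obtain ⟨π, hπ⟩ := hU .odd
  refine eq_winSet_of_forces hσ hπ (fun v => ?_) (fun v hv => ?_) ?_
  · obtain ⟨z, hz⟩ := hcov v trivial
    cases z
    · exact Or.inl hz
    · exact Or.inr hz
  · obtain ⟨g, hg, hφ⟩ := h.exists_isMeasure lift_mono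
    rw [hφ]
    exact (eq_top_of_forces_even hg hσ hv).ge
  · obtain ⟨g, hg, hlt⟩ := exists_isMeasure_lt_top hπ hk
    exact Set.disjoint_left.2 fun v hv hvU => (hlt v hvU).not_ge (h.sound g hg ⊤ hv)

theorem operations_le {n d w a b : ℕ} (hn : 0 < n) (hd : 0 < d) (hw : 0 < w)
    (ha : a ≤ 2 * (n * w + 1)) (hb : b ≤ (4 + 2 * d) * (n * w + 1) + 6 + 9 * (n * w)) :
    a ≤ 27 * (n * w) ∧ b ≤ 27 * (d * n * w) ∧ a + b ≤ 31 * (d * n * w) := by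
  have h1 : 0 < n * w := Nat.mul_pos hn hw
  have h2 : n * w ≤ d * (n * w) := Nat.le_mul_of_pos_left _ hd
  have h3 : d ≤ d * (n * w) := Nat.le_mul_of_pos_right _ h1
  rw [mul_assoc d]
  have h4 : (4 + 2 * d) * (n * w + 1) = 4 * (n * w) + 4 + 2 * (d * (n * w)) + 2 * d := by ring
  omega

end OPM

/-! ### Assembly and absolute constants. -/

theorem mainTheorem2 :
    ∃ K : ℕ, ∀ (V : Type*) [Fintype V] [Nonempty V] (n d : ℕ) (G : ParityGame V d),
      Fintype.card V = n →
      -- bounds on the number of ranks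
      (2 ≤ n → Fintype.card (OPM.𝓦 n d) ≤ n ^ (K * (1 + Nat.log 2 d))) ∧
      (d ≤ Nat.log 2 n → Fintype.card (OPM.𝓦 n d) ≤ n ^ K) ∧
      -- the algorithm terminates, computes the winning sets, and satisfies the resource bounds
      ∃ (t : Symbolic.Config (BlackBox.State (OPM.𝓦 n d)) (BlackBox.Cell (OPM.𝓦 n d)) V)
        (cost : Symbolic.Cost) (S : Set V),
        Symbolic.Exec G (BlackBox.algorithm OPM.lift) (BlackBox.start (OPM.𝓦 n d) V) t cost ∧
        t.mem (.node ⊤) = some S ∧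
        S = G.winSet .even ∧ Sᶜ = G.winSet .odd ∧
        cost.oneStep ≤ K * (n * Fintype.card (OPM.𝓦 n d)) ∧
        cost.basic ≤ K * (d * n * Fintype.card (OPM.𝓦 n d)) ∧
        cost.space ≤ K * n ∧
        (2 ≤ n → cost.oneStep + cost.basic ≤ n ^ (K * (1 + Nat.log 2 d))) ∧
        (d ≤ Nat.log 2 n → cost.oneStep + cost.basic ≤ n ^ K) := by
  -- The value `27` comes from the basic operations: bounding each term of `(4 + 2 * d) * (n * w +
  -- 1) + 6 + 9 * (n * w)` by a multiple of `d * n * w` gives `4 + 4 + 2 + 2 + 6 + 9`. It also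
  -- covers the space bound `2 * n + 6` and all exponents below.
  refine ⟨27, fun V _ _ n d G hn => ?_⟩
  have hn0 : 0 < n := hn ▸ Fintype.card_pos
  have hd : 0 < d := by
    obtain ⟨v⟩ := ‹Nonempty V›
    exact (Nat.zero_le _).trans_lt (G.priority v).2
  -- A game with a vertex has `d > 0`, which excludes `n = 1`, where the logarithm is `0`.
  have hn2 : d ≤ Nat.log 2 n → 2 ≤ n := fun h => by
    by_contra hlt
    rw [Nat.log_of_lt (by omega)] at h
    omega
  refine ⟨fun h => (OPM.card_ranks_le_pow_log d h).trans (Nat.pow_le_pow_right hn0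
      (Nat.mul_le_mul_right _ (by norm_num))),
    fun h => (OPM.card_ranks_le_pow (hn2 h) h).trans (Nat.pow_le_pow_right hn0 (by norm_num)), ?_⟩
  obtain ⟨_, cost, hex, hspace, s, K, P, X, S, T, φ, rfl, hinv, ha, hb⟩ :=
    BlackBox.runs_algorithm (G := G) (OPM.bot_ne_top (k := Nat.log 2 n + 1)) OPM.lift
  rw [hn] at hspace ha hb
  obtain ⟨h1, h2, h3⟩ := OPM.operations_le hn0 hd (Fintype.card_pos (α := OPM.𝓦 n d)) ha hb
  obtain ⟨he, ho⟩ := OPM.eq_winSet_of_outerInv hinv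
    (hn ▸ Nat.lt_pow_succ_log_self (b := 2) (by norm_num) n)
  -- The constant factor of the operation count is absorbed into the exponent.
  have h31 : 2 ≤ n → 31 ≤ n ^ 5 := fun h =>
    (by norm_num : 31 ≤ 2 ^ 5).trans (Nat.pow_le_pow_left h 5)
  refine ⟨_, cost, φ ⊤, hex, if_pos hinv.tree.top_mem, he, ho, h1, h2, by omega, fun h => ?_,
    fun h => ?_⟩
  · have hdn : d ≤ n ^ (1 + Nat.log 2 d) := by
      refine ((Nat.lt_pow_succ_log_self (b := 2) (by norm_num) d).le).trans ?_
      rw [Nat.succ_eq_add_one, add_comm]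
      exact Nat.pow_le_pow_left h _
    have hl : 1 ≤ 1 + Nat.log 2 d := by omega
    calc _ ≤ 31 * (d * n * Fintype.card (OPM.𝓦 n d)) := h3
      _ ≤ n ^ 5 * (n ^ (1 + Nat.log 2 d) * n * n ^ (3 * (1 + Nat.log 2 d))) :=
        Nat.mul_le_mul (h31 h) (Nat.mul_le_mul (Nat.mul_le_mul_right _ hdn)
          (OPM.card_ranks_le_pow_log d h))
      _ = n ^ (6 + 4 * (1 + Nat.log 2 d)) := by ring
      _ ≤ _ := Nat.pow_le_pow_right hn0 (by omega)
  · have hdn : d ≤ n := h.trans (Nat.log_le_self 2 n)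
    calc _ ≤ 31 * (d * n * Fintype.card (OPM.𝓦 n d)) := h3
      _ ≤ n ^ 5 * (n * n * n ^ 7) :=
        Nat.mul_le_mul (h31 (hn2 h)) (Nat.mul_le_mul (Nat.mul_le_mul_right _ hdn)
          (OPM.card_ranks_le_pow (hn2 h) h))
      _ = n ^ 14 := by ring
      _ ≤ _ := Nat.pow_le_pow_right hn0 (by norm_num)
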